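/- A $k$-graph is a set of $k$-element subsets (edges) of a finite vertex set; a set of vertices is independent if it contains no edge, and $\alpha(H)$ is the maximum size of an independent set of $H$. The $r$-degree of an $r$-set $R$ of vertices of an $(r+1)$-graph is the number of edges containing $R$. A partial Steiner $(m,r+1,r)$-system is an $(r+1)$-graph on $m$ vertices in which every $r$-set has $r$-degree at most $1$. For an $(r+1)$-graph $S$ on $\{1,\dots,m\}$ and $d\ge 1$, the blowup $S(d)$ has as vertex set a disjoint union of sets $V_1,\dots,V_m$ of size $d$; its edges are all $(r+1)$-subsets of each $V_i$ and all sets $\{v_1,\dots,v_{r+1}\}$ with $v_j\in V_{x_j}$ for some edge $\{x_1,\dots,x_{r+1}\}$ of $S$. Let $H_{n,r+1,p}$ be the random $(r+1)$-graph on $n$ vertices in which every $(r+1)$-set is an edge independently with probability $p$. Logarithms are natural, and $f\ll g$ means $f(n)/g(n)\to 0$ as $n\to\infty$. Let $r\ge 2$. (1) If $S$ is a partial Steiner $(m,r+1,r)$-system with at least one edge and $d\ge 1$, then $S(d)$ has maximum $r$-degree exactly $d$ and $\alpha(S(d))=\min(r,d)\,\alpha(S)$. (2) There are $a_r,b_r>0$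 depending only on $r$ such that for every $m\ge r+1$ there is a partial Steiner $(m,r+1,r)$-system $S$ with $\alpha(S)\le a_r(m\log m)^{1/r}$ such that, for every $d\ge 1$, the blowup $S(d)$, which has $N=md$ vertices, has maximum $r$-degree $d$ and $\alpha(S(d))\le b_r\bigl(\frac Nd\log\frac Nd\bigr)^{1/r}$. (3) There is $b_r>0$ depending only on $r$ such that for all $d\ge 1$ and all $n>rd$ there is an $(r+1)$-graph $H$ on $n$ vertices with maximum $r$-degree $d$ and $\alpha(H)\le b_r\bigl(\frac nd\log\frac nd\bigr)^{1/r}$. (4) Let $d=d(n)$ be positive integers with $\log n\ll d$ and $d\le n-r$ for all large $n$, and let $p=d/(n-r)$. Then for every $\varepsilon>0$, with probability tending to $1$ as $n\to\infty$, $H=H_{n,r+1,p}$ satisfies: every $r$-set has $r$-degree between $(1-\varepsilon)d$ and $(1+\varepsilon)d$, and $\alpha(H)\le(1+\varepsilon)(r+1)!^{1/r}\bigl(\frac nd\log n\bigr)^{1/r}$. (5) Let $d=d(n)$ be positive integers with $\log n\ll d$ and $\log d\ll\log n$. Then for every $\varepsilon>0$, with probability tending to $1$, $H=H_{n,r+1,p}$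 with $p=d/(n-r)$ has all $r$-degrees between $(1-\varepsilon)d$ and $(1+\varepsilon)d$ and $\alpha(H)\le(1+\varepsilon)(r+1)!^{1/r}\bigl(\frac nd\log\frac nd\bigr)^{1/r}$. Moreover, for all sufficiently large $n$ there is an $(r+1)$-graph $H$ on $n$ vertices with maximum $r$-degree exactly $d$ and $\alpha(H)\le(1+\varepsilon)(r+1)!^{1/r}\bigl(\frac nd\log\frac nd\bigr)^{1/r}$. (6) Call a real number $c$ a lower-bound constant for $r$ if, for all sufficiently large $n$, every $(r+1)$-graph $H$ on $n$ vertices with maximum $r$-degree $d<n/(\log n)^{3r^2}$ satisfies $\alpha(H)\ge c\bigl(\frac nd\log\frac nd\bigr)^{1/r}$ (the right-hand side being read as $0$ if $d=0$). Every lower-bound constant $c$ for $r$ satisfies $c\le (r+1)!^{1/r}$. Finally, $(r+1)!^{1/r}\sim r/e$ as $r\to\infty$; consequently, if $c_r$ is a lower-bound constant for $r$ for each $r\ge2$, then for every $\varepsilon>0$ we have $c_r\le(1+\varepsilon)\,r/e$ for all sufficiently large $r$. In this sense a lower bound with $c_r\sim r/e$ is asymptotically sharp for large $r$. -/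

import Mathlib

open Filter Topology Asymptotics

/-- A `k`-graph with vertex set the (finite) type `V`: a set of `k`-element subsets of `V`. -/
structure KGraph (k : ℕ) (V : Type*) where
  edges : Finset (Finset V)
  card_edge : ∀ e ∈ edges, e.card = k

namespace KGraph

variable {k r : ℕ} {V : Type*}

/-- A set of vertices is independent if it contains no edge. -/
def IsIndep (H : KGraph k V) (Z : Finset V) : Prop :=
  ∀ e ∈ H.edges, ¬ e ⊆ Z

open Classical in
/-- The independence number: the maximum size of an independent set. -/
noncomputable def indepNum [Fintype V] (H : KGraph k V) : ℕ :=
  ((Finset.univ : Finset (Finset V)).filter H.IsIndep).sup Finset.card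

/-- The degree of a set `R` of vertices: the number of edges containing `R`. -/
def degree [DecidableEq V] (H : KGraph k V) (R : Finset V) : ℕ :=
  (H.edges.filter (fun e => R ⊆ e)).card

/-- The maximum `r`-degree of an `(r+1)`-graph: the maximum number of edges containing a common
`r`-set of vertices. -/
def maxDegree [Fintype V] [DecidableEq V] (H : KGraph (r + 1) V) : ℕ :=
  ((Finset.univ : Finset V).powersetCard r).sup H.degree

/-- `H` is a partial Steiner `(n, r+1, r)`-system (where `n = |V|`): each `r`-set of vertices is
contained in at most one edge. -/
def IsPartialSteiner [DecidableEq V] (H : KGraph (r + 1) V) : Prop :=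
  ∀ R : Finset V, R.card = r → H.degree R ≤ 1

open Classical in
/-- The `d`-fold blowup of an `(r+1)`-graph `S`. Each vertex `i` is replaced by the set
`V_i = {i} × Fin d` of size `d`; the edges are all `(r+1)`-subsets of each `V_i`, together with all
sets `{v_1, …, v_{r+1}}` with `v_j ∈ V_{x_j}` for some edge `{x_1, …, x_{r+1}}` of `S`.
(An `(r+1)`-set whose projection is an edge of `S` meets each of the `r+1` corresponding parts in
exactly one vertex.) -/
noncomputable def blowup [Fintype V] (S : KGraph (r + 1) V) (d : ℕ) :
    KGraph (r + 1) (V × Fin d) where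
  edges := ((Finset.univ : Finset (V × Fin d)).powersetCard (r + 1)).filter
    (fun e => (∃ i : V, ∀ v ∈ e, v.1 = i) ∨ e.image Prod.fst ∈ S.edges)
  card_edge := fun _ he => (Finset.mem_powersetCard.1 (Finset.mem_filter.1 he).1).2

open Classical in
/-- The `k`-graph whose edges are the `k`-element members of the family `E`. -/
noncomputable def ofSet [Fintype V] (k : ℕ) (E : Set (Finset V)) : KGraph k V where
  edges := (Finset.univ : Finset (Finset V)).filter (fun e => e.card = k ∧ e ∈ E)
  card_edge := fun _ he => (Finset.mem_filter.1 he).2.1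

/-- The probability of the event `A` for the random `k`-graph `H_{n,k,p}` on `n` vertices, each
`k`-set of vertices being an edge independently with probability `p`. -/
noncomputable def randomProb (n k : ℕ) (p : unitInterval) (A : KGraph k (Fin n) → Prop) : ℝ :=
  (ProbabilityTheory.setBernoulli {e : Finset (Fin n) | e.card = k} p).real {E | A (ofSet k E)}

/-- The edge probability `d / (n - r)`, which makes `d` the expected degree of each `r`-set.
It is truncated to `[0, 1]`; the truncation has no effect when `d + r ≤ n` and `r < n`. -/
noncomputable def edgeProb (n r d : ℕ) : unitInterval :=
  Set.projIcc (0 : ℝ) 1 zero_le_one ((d : ℝ) / ((n : ℝ) - (r : ℝ)))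

/-- `c` is a valid constant in the lower bound `α(H) ≥ c ((n/d) log (n/d))^{1/r}` for all
`(r+1)`-graphs `H` on `n` vertices, `n` large, with maximum `r`-degree `d < n / (log n)^{3 r^2}`. -/
def IsLowerBoundConstant (r : ℕ) (c : ℝ) : Prop :=
  ∀ᶠ n : ℕ in atTop, ∀ H : KGraph (r + 1) (Fin n),
    (H.maxDegree : ℝ) < (n : ℝ) / Real.log n ^ (3 * r ^ 2) →
    c * ((n : ℝ) / H.maxDegree * Real.log ((n : ℝ) / H.maxDegree)) ^ (1 / (r : ℝ))
      ≤ (H.indepNum : ℝ)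

end KGraph

/-!
Blowing up a partial Steiner system `S` gives maximum `r`-degree `d`, since an `r`-set inside a part
lies in `d - r` edges, and an `r`-set meeting `r` distinct parts has its extensions confined to one
further part. A maximum independent set of the blowup consists of `min r d` vertices from each part
of an independent set of `S`. Sparse Steiner systems come from the local lemma: choose each
`(r+1)`-set with probability `p` of order `1 / m`, and avoid both the pairs of chosen sets sharing
`r` elements and the independent `k`-sets. The latter may depend on everything, but each of them
has weight only `1 / (2 * choose m k)`, so together they cost a constant factor.

For the random hypergraph, Chernoff bounds control the degrees (`log n ≪ d`) and a first moment
bound on independent `k`-sets controls the independence number. A hypergraph of maximum degree at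
most `d` can be completed by adding edges until the degree is exactly `d`, which only decreases the
independence number. Taking `d = ⌈log² n⌉` then bounds every lower-bound constant, and Stirling's
formula evaluates `(r+1)!^{1/r}`.
-/

section Chernoff

open MeasureTheory ProbabilityTheory

variable {Ω ι : Type*} [MeasurableSpace Ω] {μ : Measure Ω} [IsProbabilityMeasure μ]

theorem mgf_le_exp_of_mem_Icc_zero_one {X : Ω → ℝ} (hX : AEMeasurable X μ)
    (h01 : ∀ᵐ ω ∂μ, X ω ∈ Set.Icc 0 1) (t : ℝ) :
    mgf X μ t ≤ Real.exp ((Real.exp t - 1) * μ[X]) := by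
  have hint : Integrable X μ := .of_mem_Icc 0 1 hX h01
  have hconvex : ∀ᵐ ω ∂μ, Real.exp (t * X ω) ≤ (Real.exp t - 1) * X ω + 1 := by
    filter_upwards [h01] with ω hω
    have := convexOn_exp.2 (Set.mem_univ t) (Set.mem_univ 0) hω.1 (sub_nonneg.2 hω.2)
      (add_sub_cancel _ _)
    simp only [smul_eq_mul, mul_zero, add_zero, Real.exp_zero, mul_one] at this
    rw [mul_comm t]
    linarith
  calc mgf X μ t ≤ ∫ ω, ((Real.exp t - 1) * X ω + 1) ∂μ :=
        integral_mono_ae (integrable_exp_mul_of_mem_Icc hX h01)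
          ((hint.const_mul _).add (integrable_const _)) hconvex
    _ = (Real.exp t - 1) * μ[X] + 1 := by
        rw [integral_add (hint.const_mul _) (integrable_const _), integral_const_mul]
        simp
    _ ≤ Real.exp ((Real.exp t - 1) * μ[X]) := Real.add_one_le_exp _

variable {X : ι → Ω → ℝ}

theorem mgf_sum_le_exp (hindep : iIndepFun X μ) (hX : ∀ i, Measurable (X i))
    (h01 : ∀ i ω, X i ω ∈ Set.Icc 0 1) (s : Finset ι) {t : ℝ} (ht : |t| ≤ 1) :
    mgf (∑ i ∈ s, X i) μ t ≤ Real.exp ((t + t ^ 2) * ∑ i ∈ s, μ[X i]) := by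
  have hmean : ∀ i ∈ s, 0 ≤ μ[X i] := fun i _ => integral_nonneg fun ω => (h01 i ω).1
  have hexp : Real.exp t - 1 ≤ t + t ^ 2 := by
    linarith [(abs_le.1 (Real.abs_exp_sub_one_sub_id_le ht)).2]
  calc mgf (∑ i ∈ s, X i) μ t
      = ∏ i ∈ s, mgf (X i) μ t := hindep.mgf_sum hX s
    _ ≤ ∏ i ∈ s, Real.exp ((Real.exp t - 1) * μ[X i]) :=
        Finset.prod_le_prod (fun _ _ => mgf_nonneg) fun i _ =>
          mgf_le_exp_of_mem_Icc_zero_one (hX i).aemeasurable (.of_forall (h01 i)) t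
    _ = Real.exp ((Real.exp t - 1) * ∑ i ∈ s, μ[X i]) := by
        rw [← Real.exp_sum, Finset.mul_sum]
    _ ≤ Real.exp ((t + t ^ 2) * ∑ i ∈ s, μ[X i]) := by
        gcongr
        exact Finset.sum_nonneg hmean

theorem integrable_exp_mul_sum (hX : ∀ i, Measurable (X i))
    (h01 : ∀ i ω, X i ω ∈ Set.Icc 0 1) (s : Finset ι) (t : ℝ) :
    Integrable (fun ω => Real.exp (t * (∑ i ∈ s, X i) ω)) μ := by
  refine integrable_exp_mul_of_mem_Icc (a := 0) (b := s.card)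
    (Finset.aemeasurable_sum s fun i _ => (hX i).aemeasurable) (.of_forall fun ω => ?_)
  rw [Finset.sum_apply]
  exact ⟨Finset.sum_nonneg fun i _ => (h01 i ω).1,
    (Finset.sum_le_sum fun i _ => (h01 i ω).2).trans (by simp)⟩

-- The exponent `-δ² / 4` comes from the choice `t = ±δ / 2` in Chernoff's method.
theorem measureReal_mul_le_abs_sum_sub_le (hindep : iIndepFun X μ)
    (hX : ∀ i, Measurable (X i)) (h01 : ∀ i ω, X i ω ∈ Set.Icc 0 1) (s : Finset ι) {δ : ℝ}
    (hδ : 0 ≤ δ) (hδ1 : δ ≤ 1) :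
    μ.real {ω | δ * ∑ i ∈ s, μ[X i] ≤ |∑ i ∈ s, X i ω - ∑ i ∈ s, μ[X i]|} ≤
      2 * Real.exp (-(δ ^ 2 / 4 * ∑ i ∈ s, μ[X i])) := by
  set M := ∑ i ∈ s, μ[X i] with hM
  have hmgf {t : ℝ} (ht : |t| ≤ 1) := mgf_sum_le_exp hindep hX h01 s ht
  have hint := integrable_exp_mul_sum (μ := μ) hX h01 s
  have habs : |δ / 2| ≤ 1 := abs_le.2 ⟨by linarith, by linarith⟩
  have hupper : μ.real {ω | (1 + δ) * M ≤ (∑ i ∈ s, X i) ω} ≤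
      Real.exp (-(δ ^ 2 / 4 * M)) := by
    refine (measure_ge_le_exp_mul_mgf _ (by positivity) (hint (δ / 2))).trans ?_
    refine (mul_le_mul_of_nonneg_left (hmgf habs) (Real.exp_nonneg _)).trans_eq ?_
    rw [← Real.exp_add, ← hM]
    ring_nf
  have hlower : μ.real {ω | (∑ i ∈ s, X i) ω ≤ (1 - δ) * M} ≤
      Real.exp (-(δ ^ 2 / 4 * M)) := by
    refine (measure_le_le_exp_mul_mgf _ (by linarith) (hint (-(δ / 2)))).trans ?_
    refine (mul_le_mul_of_nonneg_left (hmgf (by rwa [abs_neg])) (Real.exp_nonneg _)).trans_eq ?_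
    rw [← Real.exp_add, ← hM]
    ring_nf
  have hsub : {ω | δ * M ≤ |∑ i ∈ s, X i ω - M|} ⊆
      {ω | (1 + δ) * M ≤ (∑ i ∈ s, X i) ω} ∪ {ω | (∑ i ∈ s, X i) ω ≤ (1 - δ) * M} := by
    intro ω hω
    simp only [Set.mem_union, Set.mem_ofPred_eq, Finset.sum_apply] at hω ⊢
    rcases le_abs.1 hω with h | h
    · left; linarith
    · right; linarith
  have hunion : μ.real {ω | δ * M ≤ |∑ i ∈ s, X i ω - M|} ≤ _ :=
    (measureReal_mono hsub).trans (measureReal_union_le _ _)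
  linarith

end Chernoff

section LocalLemma

open MeasureTheory

variable {Ω ι : Type*} {A : ι → Set Ω}

/-- The event that none of the events `A i` with `i ∈ T` occurs. -/
def avoiding (A : ι → Set Ω) (T : Finset ι) : Set Ω := {ω | ∀ i ∈ T, ω ∉ A i}

theorem avoiding_anti {T₁ T₂ : Finset ι} (h : T₁ ⊆ T₂) : avoiding A T₂ ⊆ avoiding A T₁ :=
  fun _ hω i hi => hω i (h hi)

theorem avoiding_insert [DecidableEq ι] (a : ι) (T : Finset ι) :
    avoiding A (insert a T) = avoiding A T \ A a := by
  ext ω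
  simp only [avoiding, Finset.forall_mem_insert, Set.mem_ofPred_eq, Set.mem_sdiff, and_comm]

variable [MeasurableSpace Ω] {μ : Measure Ω} [IsProbabilityMeasure μ] {x : ι → ℝ}

theorem prod_mul_measureReal_avoiding_le [DecidableEq ι] (hA : ∀ i, MeasurableSet (A i))
    (hx1 : ∀ i, x i ≤ 1) {T W : Finset ι}
    (h : ∀ a ∈ W, ∀ W' ⊆ W, a ∉ W' →
      μ.real (A a ∩ avoiding A (W' ∪ T)) ≤ x a * μ.real (avoiding A (W' ∪ T))) :
    (∏ j ∈ W, (1 - x j)) * μ.real (avoiding A T) ≤ μ.real (avoiding A (W ∪ T)) := by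
  induction W using Finset.induction_on with
  | empty => simp
  | insert a W ha ih =>
    have hW := ih fun b hb W' hW' =>
      h b (Finset.mem_insert_of_mem hb) W' (hW'.trans (Finset.subset_insert a W))
    have hcond := h a (Finset.mem_insert_self a W) W (Finset.subset_insert a W) ha
    have hsplit : μ.real (avoiding A (W ∪ T) \ A a) + μ.real (A a ∩ avoiding A (W ∪ T)) =
        μ.real (avoiding A (W ∪ T)) := by
      rw [Set.inter_comm, measureReal_sdiff_add_inter (hA a)]
    rw [Finset.prod_insert ha, Finset.insert_union, avoiding_insert, mul_assoc]
    linarith [mul_le_mul_of_nonneg_left hW (sub_nonneg.2 (hx1 a))]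

theorem measureReal_inter_avoiding_le {I : Finset ι} {Γ : ι → Finset ι}
    (hA : ∀ i, MeasurableSet (A i)) (hx0 : ∀ i, 0 ≤ x i) (hx1 : ∀ i, x i ≤ 1)
    (hindep : ∀ i ∈ I, ∀ T ⊆ I, Disjoint T (Γ i) →
      μ.real (A i ∩ avoiding A T) ≤ μ.real (A i) * μ.real (avoiding A T))
    (hP : ∀ i ∈ I, μ.real (A i) ≤ x i * ∏ j ∈ Γ i, (1 - x j))
    {T : Finset ι} (hT : T ⊆ I) {i : ι} (hi : i ∈ I) :
    μ.real (A i ∩ avoiding A T) ≤ x i * μ.real (avoiding A T) := by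
  classical
  induction T using Finset.strongInduction generalizing i with
  | H T ih =>
    set near := T.filter (· ∈ Γ i)
    set far := T.filter (· ∉ Γ i) with hfar
    have hunion : near ∪ far = T := Finset.filter_union_filter_not_eq _ _
    have hprod : ∏ j ∈ Γ i, (1 - x j) ≤ ∏ j ∈ near, (1 - x j) :=
      Finset.prod_le_prod_of_subset_of_le_one (fun j hj => (Finset.mem_filter.1 hj).2)
        (fun j _ => sub_nonneg.2 (hx1 j)) (fun j _ _ => by linarith [hx0 j])
    have hchain : (∏ j ∈ near, (1 - x j)) * μ.real (avoiding A far) ≤ μ.real (avoiding A T) := by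
      rw [← hunion]
      refine prod_mul_measureReal_avoiding_le hA hx1 fun a ha W hW haW => ?_
      have hsub : W ∪ far ⊆ T :=
        Finset.union_subset (hW.trans (Finset.filter_subset _ _)) (Finset.filter_subset _ _)
      have haT : a ∈ T := (Finset.mem_filter.1 ha).1
      have haW' : a ∉ W ∪ far := by simp [haW, hfar, (Finset.mem_filter.1 ha).2]
      exact ih _ (Finset.ssubset_iff_of_subset hsub |>.2 ⟨a, haT, haW'⟩) (hsub.trans hT) (hT haT)
    calc μ.real (A i ∩ avoiding A T)
        ≤ μ.real (A i ∩ avoiding A far) := measureReal_mono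
          (Set.inter_subset_inter_right _ (avoiding_anti (Finset.filter_subset _ _)))
      _ ≤ μ.real (A i) * μ.real (avoiding A far) :=
          hindep i hi far ((Finset.filter_subset _ _).trans hT)
            (Finset.disjoint_left.2 fun j hj => (Finset.mem_filter.1 hj).2)
      _ ≤ x i * (∏ j ∈ near, (1 - x j)) * μ.real (avoiding A far) := by
          gcongr
          exact (hP i hi).trans (mul_le_mul_of_nonneg_left hprod (hx0 i))
      _ ≤ x i * μ.real (avoiding A T) := by
          rw [mul_assoc]
          exact mul_le_mul_of_nonneg_left hchain (hx0 i)

/-- The **Lovász local lemma**, in its lopsided form: only an upper bound on the probability of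
`A i` given that events outside `Γ i` are avoided is needed. -/
theorem prod_le_measureReal_avoiding {I : Finset ι} {Γ : ι → Finset ι}
    (hA : ∀ i, MeasurableSet (A i)) (hx0 : ∀ i, 0 ≤ x i) (hx1 : ∀ i, x i ≤ 1)
    (hindep : ∀ i ∈ I, ∀ T ⊆ I, Disjoint T (Γ i) →
      μ.real (A i ∩ avoiding A T) ≤ μ.real (A i) * μ.real (avoiding A T))
    (hP : ∀ i ∈ I, μ.real (A i) ≤ x i * ∏ j ∈ Γ i, (1 - x j)) :
    ∏ i ∈ I, (1 - x i) ≤ μ.real (avoiding A I) := by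
  classical
  have := prod_mul_measureReal_avoiding_le (μ := μ) (T := ∅) (W := I) hA hx1 fun a ha W hW _ =>
    measureReal_inter_avoiding_le hA hx0 hx1 hindep hP (by simpa using hW) ha
  simpa [avoiding] using this

end LocalLemma

section RandomSubset

open MeasureTheory ProbabilityTheory unitInterval

variable {α : Type*} {u : Set α} {p : I}

/-- The event `A` about a subset of `α` is decided by the part of that subset inside `s`. -/
def DecidedBy (A : Set (Set α)) (s : Set α) : Prop := ∀ E, E ∩ s ∈ A ↔ E ∈ A

theorem decidedBy_setOf_subset (s : Set α) : DecidedBy {E | s ⊆ E} s := fun E => by simp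

theorem decidedBy_setOf_disjoint (s : Set α) : DecidedBy {E | Disjoint E s} s := fun E => by
  simp [Set.disjoint_iff_inter_eq_empty, Set.inter_assoc]

theorem decidedBy_avoiding {ι : Type*} [DecidableEq α] {A : ι → Set (Set α)} {s : ι → Finset α}
    {T : Finset ι} (h : ∀ i ∈ T, DecidedBy (A i) (s i)) :
    DecidedBy (avoiding A T) (T.biUnion s) := by
  refine fun E => forall₂_congr fun i hi => not_congr ?_
  have hsub : (s i : Set α) ⊆ T.biUnion s := by exact_mod_cast Finset.subset_biUnion_of_mem s hi
  rw [← h i hi (E ∩ T.biUnion s), ← h i hi E, Set.inter_assoc, Set.inter_eq_right.2 hsub]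

theorem iIndepFun_mem_setBernoulli :
    iIndepFun (fun (a : α) (E : Set α) => a ∈ E) (setBernoulli u p) := by
  have hcoord := iIndepFun_infinitePi (P := fun a : α =>
    toNNReal p • Measure.dirac (a ∈ u) + toNNReal (σ p) • Measure.dirac False)
    (X := fun _ => id) fun _ => measurable_id
  rw [iIndepFun_iff_map_fun_eq_infinitePi_map (by fun_prop)] at hcoord ⊢
  rw [setBernoulli_eq_map, Measure.map_map (by fun_prop) (by fun_prop)]
  have hmarginal (a : α) := Measure.map_map (μ := Measure.infinitePi fun a : α =>
    toNNReal p • Measure.dirac (a ∈ u) + toNNReal (σ p) • Measure.dirac False)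
    (measurable_set_mem a) MeasurableEquiv.setOfPred.measurable
  simp only [MeasurableEquiv.coe_setOfPred] at hmarginal
  simp_rw [hmarginal]
  exact hcoord

theorem measureReal_setBernoulli_inter_of_disjoint {A B : Set (Set α)} {s t : Finset α}
    (hA : DecidedBy A s) (hB : DecidedBy B t) (hst : Disjoint s t) :
    (setBernoulli u p).real (A ∩ B) = (setBernoulli u p).real A * (setBernoulli u p).real B := by
  have hpre {C : Set (Set α)} {w : Finset α} (hC : DecidedBy C w) :
      C = (fun (E : Set α) (a : w) => (a : α) ∈ E) ⁻¹' {f | {a | ∃ h : a ∈ w, f ⟨a, h⟩} ∈ C} := by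
    ext E
    rw [← hC E]
    simp only [Set.preimage_ofPred_eq, Set.mem_ofPred_eq, exists_prop]
    congr! 1
    ext a
    exact and_comm
  have hindep := (iIndepFun_mem_setBernoulli (u := u) (p := p)).indepFun_finset s t hst
    measurable_set_mem
  rw [hpre hA, hpre hB, measureReal_def,
    hindep.measure_inter_preimage_eq_mul _ _ .of_discrete .of_discrete, ENNReal.toReal_mul]
  rfl

theorem measureReal_setBernoulli_mem {a : α} (ha : a ∈ u) :
    (setBernoulli u p).real {E | a ∈ E} = p := by
  have heval := (measurePreserving_eval_infinitePi (fun a : α =>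
    toNNReal p • Measure.dirac (a ∈ u) + toNNReal (σ p) • Measure.dirac False) a).measure_preimage
    (MeasurableSet.singleton True).nullMeasurableSet
  have hpre : (fun q : α → Prop => {i | q i}) ⁻¹' {E | a ∈ E} =
      Function.eval a ⁻¹' ({True} : Set Prop) := by
    ext; simp
  rw [measureReal_def, setBernoulli_apply', hpre, heval]
  simp [ha]

theorem measureReal_setBernoulli_notMem {a : α} (ha : a ∈ u) :
    (setBernoulli u p).real {E | a ∉ E} = 1 - p := by
  rw [← measureReal_setBernoulli_mem ha,
    ← probReal_compl_eq_one_sub (measurableSet_setOfPred.2 (measurable_set_mem a))]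
  rfl

theorem measureReal_setBernoulli_superset {s : Finset α} (hs : ↑s ⊆ u) :
    (setBernoulli u p).real {E | ↑s ⊆ E} = p ^ s.card := by
  have hinter : {E : Set α | ↑s ⊆ E} = ⋂ a ∈ s, (fun E : Set α => a ∈ E) ⁻¹' {True} := by
    ext; simp [Set.subset_def]
  rw [hinter, measureReal_def, iIndepFun_mem_setBernoulli.measure_inter_preimage_eq_mul _
    fun _ _ => .of_discrete, ENNReal.toReal_prod, ← Finset.prod_const]
  refine Finset.prod_congr rfl fun a ha => ?_
  rw [← measureReal_setBernoulli_mem (u := u) (p := p) (hs ha)]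
  simp [measureReal_def, Set.preimage]

theorem measureReal_setBernoulli_disjoint {s : Finset α} (hs : ↑s ⊆ u) :
    (setBernoulli u p).real {E | Disjoint E ↑s} = (1 - p) ^ s.card := by
  have hinter : {E : Set α | Disjoint E ↑s} = ⋂ a ∈ s, (fun E : Set α => a ∈ E) ⁻¹' {False} := by
    ext; simp [Set.disjoint_right]
  rw [hinter, measureReal_def, iIndepFun_mem_setBernoulli.measure_inter_preimage_eq_mul _
    fun _ _ => .of_discrete, ENNReal.toReal_prod, ← Finset.prod_const]
  refine Finset.prod_congr rfl fun a ha => ?_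
  rw [← measureReal_setBernoulli_notMem (u := u) (p := p) (hs ha)]
  simp [measureReal_def, Set.preimage]

end RandomSubset

namespace KGraph

section Basic

variable {k r : ℕ} {V : Type*}

theorem IsIndep.mono {H : KGraph k V} {Y Z : Finset V} (hZ : H.IsIndep Z) (hYZ : Y ⊆ Z) :
    H.IsIndep Y :=
  fun e he hs => hZ e he (hs.trans hYZ)

theorem isIndep_empty (H : KGraph (r + 1) V) : H.IsIndep ∅ := by
  intro e he hs
  have := H.card_edge e he
  simp [Finset.subset_empty.1 hs] at this

variable [Fintype V]

theorem indepNum_le_iff {H : KGraph k V} {c : ℕ} :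
    H.indepNum ≤ c ↔ ∀ Z, H.IsIndep Z → Z.card ≤ c := by
  simp [indepNum]

theorem IsIndep.card_le_indepNum {H : KGraph k V} {Z : Finset V} (hZ : H.IsIndep Z) :
    Z.card ≤ H.indepNum :=
  indepNum_le_iff.1 le_rfl Z hZ

theorem exists_isIndep_of_le_indepNum (H : KGraph (r + 1) V) {c : ℕ} (hc : c ≤ H.indepNum) :
    ∃ Z, H.IsIndep Z ∧ Z.card = c := by
  classical
  obtain ⟨Z, hZ, hsup⟩ := Finset.exists_mem_eq_sup (Finset.univ.filter H.IsIndep)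
    ⟨∅, by simpa using H.isIndep_empty⟩ Finset.card
  have hZc : c ≤ Z.card := by
    rw [← hsup]
    exact hc.trans_eq (by rw [indepNum])
  obtain ⟨Y, hYZ, hY⟩ := Finset.exists_subset_card_eq hZc
  exact ⟨Y, (Finset.mem_filter.1 hZ).2.mono hYZ, hY⟩

theorem indepNum_le_of_edges_subset {H H' : KGraph k V} (h : H.edges ⊆ H'.edges) :
    H'.indepNum ≤ H.indepNum :=
  indepNum_le_iff.2 fun _ hZ => IsIndep.card_le_indepNum fun e he => hZ e (h he)

variable [DecidableEq V]

theorem maxDegree_le_iff {H : KGraph (r + 1) V} {c : ℕ} :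
    H.maxDegree ≤ c ↔ ∀ R : Finset V, R.card = r → H.degree R ≤ c := by
  simp [maxDegree]

theorem degree_le_maxDegree (H : KGraph (r + 1) V) {R : Finset V} (hR : R.card = r) :
    H.degree R ≤ H.maxDegree :=
  maxDegree_le_iff.1 le_rfl R hR

/-- The link of a set `R` of vertices: the vertices that complete `R` to an edge. -/
def link (H : KGraph k V) (R : Finset V) : Finset V :=
  Finset.univ.filter fun v => v ∉ R ∧ insert v R ∈ H.edges

theorem mem_link {H : KGraph k V} {R : Finset V} {v : V} :
    v ∈ H.link R ↔ v ∉ R ∧ insert v R ∈ H.edges := by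
  simp [link]

theorem degree_eq_card_link (H : KGraph (r + 1) V) {R : Finset V} (hR : R.card = r) :
    H.degree R = (H.link R).card := by
  have himage : H.edges.filter (fun e => R ⊆ e) = (H.link R).image fun v => insert v R := by
    ext e
    simp only [Finset.mem_filter, Finset.mem_image, mem_link]
    constructor
    · rintro ⟨he, hRe⟩
      obtain ⟨v, hv, rfl⟩ := Finset.exists_eq_insert_iff.2 ⟨hRe, by rw [hR, H.card_edge e he]⟩
      exact ⟨v, ⟨hv, he⟩, rfl⟩
    · rintro ⟨v, ⟨-, he⟩, rfl⟩
      exact ⟨he, Finset.subset_insert v R⟩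
  rw [degree, himage, Finset.card_image_of_injOn]
  exact (Finset.insert_inj_on R).mono fun v hv => (mem_link.1 hv).1

end Basic

section Comap

variable {k r : ℕ} {V W : Type*} [DecidableEq V] [Fintype W]

/-- The hypergraph induced along an embedding of vertex sets. -/
def comap (H : KGraph k V) (f : W ↪ V) : KGraph k W where
  edges := Finset.univ.filter fun e => e.map f ∈ H.edges
  card_edge e he := by
    rw [← H.card_edge _ (Finset.mem_filter.1 he).2, Finset.card_map]

theorem mem_comap_edges {H : KGraph k V} {f : W ↪ V} {e : Finset W} :
    e ∈ (H.comap f).edges ↔ e.map f ∈ H.edges := by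
  simp [comap]

theorem indepNum_comap_le [Fintype V] (H : KGraph k V) (f : W ↪ V) :
    (H.comap f).indepNum ≤ H.indepNum := by
  refine indepNum_le_iff.2 fun Z hZ => ?_
  rw [← Finset.card_map f]
  refine IsIndep.card_le_indepNum fun e he hs => ?_
  obtain ⟨e', he', rfl⟩ := Finset.subset_map_iff.1 hs
  exact hZ e' (mem_comap_edges.2 he) he'

theorem degree_comap_le [DecidableEq W] (H : KGraph k V) (f : W ↪ V) (R : Finset W) :
    (H.comap f).degree R ≤ H.degree (R.map f) := by
  refine Finset.card_le_card_of_injOn (fun e => e.map f) (fun e he => ?_)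
    (Finset.map_injective f).injOn
  simp only [Finset.coe_filter, Set.mem_ofPred_eq] at he ⊢
  exact ⟨mem_comap_edges.1 he.1, Finset.map_subset_map.2 he.2⟩

theorem maxDegree_comap_le [Fintype V] [DecidableEq W] (H : KGraph (r + 1) V) (f : W ↪ V) :
    (H.comap f).maxDegree ≤ H.maxDegree :=
  maxDegree_le_iff.2 fun R hR =>
    (H.degree_comap_le f R).trans (H.degree_le_maxDegree (by rw [Finset.card_map, hR]))

end Comap

section InsertEdge

variable {k r d : ℕ} {V : Type*} [DecidableEq V]

/-- The hypergraph obtained by adding the edge `e` to `H`. -/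
def insertEdge (H : KGraph k V) (e : Finset V) (he : e.card = k) : KGraph k V where
  edges := insert e H.edges
  card_edge := Finset.forall_mem_insert _ _ _ |>.2 ⟨he, H.card_edge⟩

theorem degree_insertEdge_le (H : KGraph k V) {e : Finset V} (he : e.card = k) (R : Finset V) :
    (H.insertEdge e he).degree R ≤ H.degree R + 1 := by
  simp only [degree, insertEdge, Finset.filter_insert]
  split_ifs
  · exact Finset.card_insert_le _ _
  · exact Nat.le_succ _

theorem maxDegree_insertEdge_le [Fintype V] (H : KGraph (r + 1) V) {e : Finset V}
    (he : e.card = r + 1) : (H.insertEdge e he).maxDegree ≤ H.maxDegree + 1 :=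
  maxDegree_le_iff.2 fun R hR =>
    (H.degree_insertEdge_le he R).trans (Nat.succ_le_succ (H.degree_le_maxDegree hR))

theorem exists_notMem_edges_of_maxDegree_add_lt [Fintype V] (H : KGraph (r + 1) V)
    (hV : H.maxDegree + r < Fintype.card V) : ∃ e, e.card = r + 1 ∧ e ∉ H.edges := by
  obtain ⟨R, hR⟩ : ∃ R : Finset V, R.card = r := by
    obtain ⟨R, -, hR⟩ := Finset.exists_subset_card_eq (s := (Finset.univ : Finset V)) (n := r)
      (by rw [Finset.card_univ]; omega)
    exact ⟨R, hR⟩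
  have hcard : (H.link R).card < Rᶜ.card := by
    rw [← H.degree_eq_card_link hR, Finset.card_compl, hR]
    have := H.degree_le_maxDegree hR
    omega
  obtain ⟨v, hvR, hv⟩ := Finset.exists_mem_notMem_of_card_lt_card hcard
  rw [Finset.mem_compl] at hvR
  exact ⟨insert v R, by rw [Finset.card_insert_of_notMem hvR, hR],
    fun h => hv (mem_link.2 ⟨hvR, h⟩)⟩

-- Adding one edge raises the maximum degree by at most one, so a maximal hypergraph of maximum
-- degree at most `d` has maximum degree exactly `d`.
theorem exists_edges_subset_maxDegree_eq [Fintype V] (H : KGraph (r + 1) V)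
    (hd : H.maxDegree ≤ d) (hdV : d + r ≤ Fintype.card V) :
    ∃ H' : KGraph (r + 1) V, H.edges ⊆ H'.edges ∧ H'.maxDegree = d := by
  set 𝓔 : Set (Finset (Finset V)) := {E | ∃ K : KGraph (r + 1) V, K.edges = E ∧ K.maxDegree ≤ d}
  obtain ⟨_, hsub, ⟨K, rfl, hK⟩, hmax⟩ :=
    (Set.toFinite 𝓔).exists_le_maximal (a := H.edges) ⟨H, rfl, hd⟩
  refine ⟨K, hsub, hK.antisymm (not_lt.1 fun hlt => ?_)⟩
  obtain ⟨e, he, heK⟩ := K.exists_notMem_edges_of_maxDegree_add_lt (by omega)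
  have hmem : insert e K.edges ∈ 𝓔 :=
    ⟨K.insertEdge e he, rfl, (K.maxDegree_insertEdge_le he).trans hlt⟩
  exact heK (hmax hmem (Finset.subset_insert e _) (Finset.mem_insert_self e _))

end InsertEdge

section Blowup

variable {r d : ℕ} {V : Type*} [DecidableEq V]

theorem IsPartialSteiner.eq_of_subset {S : KGraph (r + 1) V} (hS : S.IsPartialSteiner)
    {R e e' : Finset V} (hR : R.card = r) (he : e ∈ S.edges) (he' : e' ∈ S.edges)
    (hRe : R ⊆ e) (hRe' : R ⊆ e') : e = e' :=
  Finset.card_le_one.1 (hS R hR) e (Finset.mem_filter.2 ⟨he, hRe⟩) e'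
    (Finset.mem_filter.2 ⟨he', hRe'⟩)

variable {S : KGraph (r + 1) V}

theorem injOn_fst_of_image_mem_edges {e : Finset (V × Fin d)} (he : e.card = r + 1)
    (hS : e.image Prod.fst ∈ S.edges) : Set.InjOn Prod.fst (e : Set (V × Fin d)) :=
  Finset.card_image_iff.1 (by rw [S.card_edge _ hS, he])

variable [Fintype V]

theorem mem_blowup_edges {e : Finset (V × Fin d)} :
    e ∈ (S.blowup d).edges ↔ e.card = r + 1 ∧
      ((∃ i : V, ∀ v ∈ e, v.1 = i) ∨ e.image Prod.fst ∈ S.edges) := by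
  simp only [blowup, Finset.mem_filter, Finset.mem_powersetCard, Finset.subset_univ, true_and]
  congr!

theorem mem_link_blowup {R : Finset (V × Fin d)} {v : V × Fin d}
    (hv : v ∈ (S.blowup d).link R) :
    (∀ u ∈ R, u.1 = v.1) ∨ (Set.InjOn Prod.fst (R : Set (V × Fin d)) ∧
      v.1 ∉ R.image Prod.fst ∧ insert v.1 (R.image Prod.fst) ∈ S.edges) := by
  obtain ⟨hvR, he⟩ := mem_link.1 hv
  obtain ⟨hcard, ⟨i, hi⟩ | hS⟩ := mem_blowup_edges.1 he
  · refine Or.inl fun u hu => ?_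
    rw [hi u (Finset.mem_insert_of_mem hu), hi v (Finset.mem_insert_self v R)]
  · have hinj := injOn_fst_of_image_mem_edges hcard hS
    rw [Finset.coe_insert, Set.injOn_insert (by simpa using hvR)] at hinj
    exact Or.inr ⟨hinj.1, by simpa using hinj.2, Finset.image_insert Prod.fst v R ▸ hS⟩

theorem fst_eq_of_mem_link_blowup (hr : 2 ≤ r) (hS : S.IsPartialSteiner)
    {R : Finset (V × Fin d)} (hR : R.card = r) {v w : V × Fin d}
    (hv : v ∈ (S.blowup d).link R) (hw : w ∈ (S.blowup d).link R) : v.1 = w.1 := by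
  have not_injOn {i : V} (hi : ∀ u ∈ R, u.1 = i) : ¬ Set.InjOn Prod.fst (R : Set (V × Fin d)) := by
    obtain ⟨a, ha, b, hb, hab⟩ := Finset.one_lt_card.1 (hr.trans_eq hR.symm)
    exact fun hinj => hab (hinj ha hb ((hi a ha).trans (hi b hb).symm))
  obtain ⟨u, hu⟩ : R.Nonempty := Finset.card_pos.1 (by omega)
  rcases mem_link_blowup hv with hRv | ⟨hinj, hvR, hve⟩ <;>
    rcases mem_link_blowup hw with hRw | ⟨hinj', -, hwe⟩
  · exact (hRv u hu).symm.trans (hRw u hu)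
  · exact absurd hinj' (not_injOn hRv)
  · exact absurd hinj (not_injOn hRw)
  · refine (Finset.insert_inj hvR).1 (hS.eq_of_subset ?_ hve hwe (Finset.subset_insert _ _)
      (Finset.subset_insert _ _))
    rw [Finset.card_image_of_injOn hinj, hR]

theorem degree_blowup_le (hr : 2 ≤ r) (hS : S.IsPartialSteiner) {R : Finset (V × Fin d)}
    (hR : R.card = r) : (S.blowup d).degree R ≤ d := by
  rw [degree_eq_card_link _ hR]
  refine (Finset.card_le_card_of_injOn Prod.snd (t := Finset.univ) (fun _ _ => Finset.mem_univ _)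
    fun v hv w hw h => ?_).trans_eq (by simp)
  exact Prod.ext (fst_eq_of_mem_link_blowup hr hS hR hv hw) h

theorem insert_image_mem_blowup_edges {x : Finset V} (hx : x ∈ S.edges) {y : V} (hy : y ∈ x)
    (g : V → Fin d) (j : Fin d) :
    insert (y, j) ((x.erase y).image fun a => (a, g a)) ∈ (S.blowup d).edges := by
  have himage : (insert (y, j) ((x.erase y).image fun a => (a, g a))).image Prod.fst = x := by
    rw [Finset.image_insert, Finset.image_image]
    exact (congrArg (insert y) Finset.image_id).trans (Finset.insert_erase hy)
  refine mem_blowup_edges.2 ⟨?_, Or.inr (himage.symm ▸ hx)⟩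
  rw [Finset.card_insert_of_notMem (by simp),
    Finset.card_image_of_injective _ fun a b h => congrArg Prod.fst h,
    Finset.card_erase_add_one hy, S.card_edge x hx]

theorem le_maxDegree_blowup (hne : S.edges.Nonempty) : d ≤ (S.blowup d).maxDegree := by
  rcases Nat.eq_zero_or_pos d with rfl | hd
  · exact Nat.zero_le _
  obtain ⟨x, hx⟩ := hne
  obtain ⟨y, hy⟩ : x.Nonempty := Finset.card_pos.1 (by rw [S.card_edge x hx]; omega)
  set R : Finset (V × Fin d) := (x.erase y).image fun a => (a, ⟨0, hd⟩) with hRdef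
  have hR : R.card = r := by
    rw [Finset.card_image_of_injective _ fun a b h => congrArg Prod.fst h,
      Finset.card_erase_of_mem hy, S.card_edge x hx, Nat.add_sub_cancel]
  have hlink : ({y} ×ˢ Finset.univ : Finset (V × Fin d)) ⊆ (S.blowup d).link R := by
    rintro ⟨v, j⟩ hv
    obtain rfl : y = v := by simpa using hv
    exact mem_link.2 ⟨by simp [hRdef], insert_image_mem_blowup_edges hx hy _ j⟩
  calc d = ({y} ×ˢ Finset.univ : Finset (V × Fin d)).card := by simp
    _ ≤ ((S.blowup d).link R).card := Finset.card_le_card hlink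
    _ = (S.blowup d).degree R := (degree_eq_card_link _ hR).symm
    _ ≤ (S.blowup d).maxDegree := degree_le_maxDegree _ hR

theorem maxDegree_blowup (hr : 2 ≤ r) (hS : S.IsPartialSteiner) (hne : S.edges.Nonempty) :
    (S.blowup d).maxDegree = d :=
  (maxDegree_le_iff.2 fun _ => degree_blowup_le hr hS).antisymm (le_maxDegree_blowup hne)

theorem IsIndep.image_fst_of_blowup {Z : Finset (V × Fin d)} (hZ : (S.blowup d).IsIndep Z) :
    S.IsIndep (Z.image Prod.fst) := by
  intro x hx hxZ
  obtain ⟨y, hy⟩ : x.Nonempty := Finset.card_pos.1 (by rw [S.card_edge x hx]; omega)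
  have hlift : ∀ a ∈ x, ∃ j, (a, j) ∈ Z := by simpa [Finset.subset_iff] using hxZ
  have : Nonempty (Fin d) := (hlift y hy).nonempty
  choose! g hg using hlift
  refine hZ _ (insert_image_mem_blowup_edges hx hy g (g y))
    (Finset.insert_subset (hg y hy) fun v hv => ?_)
  obtain ⟨a, ha, rfl⟩ := Finset.mem_image.1 hv
  exact hg a (Finset.mem_of_mem_erase ha)

theorem IsIndep.card_fiber_le_of_blowup {Z : Finset (V × Fin d)} (hZ : (S.blowup d).IsIndep Z)
    (a : V) : (Z.filter fun v => v.1 = a).card ≤ min r d := by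
  refine le_min ?_ ?_
  · by_contra! hlt
    obtain ⟨e, he, hcard⟩ := Finset.exists_subset_card_eq (Nat.succ_le_of_lt hlt)
    refine hZ e (mem_blowup_edges.2 ⟨hcard, Or.inl ⟨a, fun v hv => ?_⟩⟩)
      (he.trans (Finset.filter_subset _ _))
    exact (Finset.mem_filter.1 (he hv)).2
  · refine (Finset.card_le_card_of_injOn Prod.snd (t := Finset.univ) (fun _ _ => Finset.mem_univ _)
      fun v hv w hw h => ?_).trans_eq (by simp)
    exact Prod.ext ((Finset.mem_filter.1 hv).2.trans (Finset.mem_filter.1 hw).2.symm) h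

end Blowup

section BlowupIndepNum

variable {r d : ℕ} {V : Type*} [Fintype V] {S : KGraph (r + 1) V}

theorem IsIndep.product_of_card_le {Z : Finset V} (hZ : S.IsIndep Z) {J : Finset (Fin d)}
    (hJ : J.card ≤ r) : (S.blowup d).IsIndep (Z ×ˢ J) := by
  classical
  intro e he hs
  obtain ⟨hcard, ⟨i, hi⟩ | hS⟩ := mem_blowup_edges.1 he
  · have hle : e.card ≤ J.card :=
      Finset.card_le_card_of_injOn Prod.snd (fun v hv => (Finset.mem_product.1 (hs hv)).2)
        fun v hv w hw h => Prod.ext ((hi v hv).trans (hi w hw).symm) h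
    omega
  · refine hZ _ hS fun a ha => ?_
    obtain ⟨v, hv, rfl⟩ := Finset.mem_image.1 ha
    exact (Finset.mem_product.1 (hs hv)).1

theorem indepNum_blowup (S : KGraph (r + 1) V) :
    (S.blowup d).indepNum = min r d * S.indepNum := by
  classical
  apply le_antisymm
  · refine indepNum_le_iff.2 fun Z hZ => ?_
    calc Z.card ≤ min r d * (Z.image Prod.fst).card :=
          Finset.card_le_mul_card_image Z _ fun a _ => hZ.card_fiber_le_of_blowup a
      _ ≤ min r d * S.indepNum :=
          Nat.mul_le_mul_left _ hZ.image_fst_of_blowup.card_le_indepNum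
  · obtain ⟨Z, hZ, hZcard⟩ := S.exists_isIndep_of_le_indepNum le_rfl
    obtain ⟨J, -, hJ⟩ := Finset.exists_subset_card_eq
      (show min r d ≤ (Finset.univ : Finset (Fin d)).card by simp)
    have := (hZ.product_of_card_le (hJ.trans_le (min_le_left r d))).card_le_indepNum
    rwa [Finset.card_product, hZcard, hJ, mul_comm] at this

theorem exists_maxDegree_eq_of_isPartialSteiner [DecidableEq V] (hr : 2 ≤ r)
    (hS : S.IsPartialSteiner) {n : ℕ} (hn : n ≤ Fintype.card V * d) (hdn : d + r ≤ n) :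
    ∃ H : KGraph (r + 1) (Fin n), H.maxDegree = d ∧ H.indepNum ≤ r * S.indepNum := by
  obtain ⟨f⟩ : Nonempty (Fin n ↪ V × Fin d) :=
    Function.Embedding.nonempty_of_card_le (by simpa using hn)
  have hdeg : ((S.blowup d).comap f).maxDegree ≤ d :=
    (maxDegree_comap_le _ f).trans (maxDegree_le_iff.2 fun _ => degree_blowup_le hr hS)
  obtain ⟨H, hsub, hH⟩ := exists_edges_subset_maxDegree_eq _ hdeg (by simpa using hdn)
  refine ⟨H, hH, ?_⟩
  calc H.indepNum ≤ ((S.blowup d).comap f).indepNum := indepNum_le_of_edges_subset hsub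
    _ ≤ (S.blowup d).indepNum := indepNum_comap_le _ f
    _ = min r d * S.indepNum := indepNum_blowup S
    _ ≤ r * S.indepNum := Nat.mul_le_mul_right _ (min_le_left r d)

end BlowupIndepNum

end KGraph

theorem half_le_one_sub_one_div_two_mul_pow (M : ℕ) : (1 : ℝ) / 2 ≤ (1 - 1 / (2 * M)) ^ M := by
  rcases M.eq_zero_or_pos with rfl | hM
  · norm_num
  have hM1 : (1 : ℝ) ≤ M := by exact_mod_cast hM
  have hle : (1 : ℝ) / (2 * M) ≤ 1 := by
    rw [div_le_one (by positivity)]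
    linarith
  calc (1 : ℝ) / 2 = 1 + M * -(1 / (2 * M)) := by field_simp; norm_num
    _ ≤ (1 + -(1 / (2 * M))) ^ M := one_add_mul_le_pow (by linarith) M
    _ = (1 - 1 / (2 * M)) ^ M := by rw [← sub_eq_add_neg]

namespace KGraph

section Conflicts

variable {r : ℕ} {V : Type*} [DecidableEq V]

theorem exists_insert_erase_eq {e f : Finset V} (he : e.card = r + 1) (hf : f.card = r + 1)
    (hne : e ≠ f) (hr : r ≤ (e ∩ f).card) : ∃ u ∈ e, ∃ v, insert v (e.erase u) = f := by
  have hlt : (e ∩ f).card < e.card := Finset.card_lt_card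
    ⟨Finset.inter_subset_left, fun h => hne
      (Finset.eq_of_subset_of_card_le (Finset.subset_inter_iff.1 h).2 (hf.trans_le he.ge))⟩
  obtain ⟨u, hu, hue⟩ := Finset.exists_eq_insert_iff.2
    ⟨Finset.inter_subset_left (s₁ := e) (s₂ := f), by omega⟩
  obtain ⟨v, -, hvf⟩ := Finset.exists_eq_insert_iff.2
    ⟨Finset.inter_subset_right (s₁ := e) (s₂ := f), by omega⟩
  refine ⟨u, hue ▸ Finset.mem_insert_self u _, v, ?_⟩
  rw [← hvf, ← Finset.erase_insert hu, hue]

variable [Fintype V]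

/-- The `(r+1)`-sets other than `e` that share `r` elements with `e`. -/
def conflicts (r : ℕ) (e : Finset V) : Finset (Finset V) :=
  (Finset.univ.powersetCard (r + 1)).filter fun f => e ≠ f ∧ r ≤ (e ∩ f).card

theorem card_conflicts_le {e : Finset V} (he : e.card = r + 1) :
    (conflicts r e).card ≤ (r + 1) * Fintype.card V := by
  have hsub : conflicts r e ⊆
      (e ×ˢ (Finset.univ : Finset V)).image fun x => insert x.2 (e.erase x.1) := by
    intro f hf
    obtain ⟨hfcard, hne, hr⟩ := Finset.mem_filter.1 hf
    obtain ⟨u, hu, v, rfl⟩ :=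
      exists_insert_erase_eq he (Finset.mem_powersetCard.1 hfcard).2 hne hr
    exact Finset.mem_image.2 ⟨(u, v), by simp [hu], rfl⟩
  calc (conflicts r e).card ≤ (e ×ˢ (Finset.univ : Finset V)).card :=
        (Finset.card_le_card hsub).trans Finset.card_image_le
    _ = (r + 1) * Fintype.card V := by rw [Finset.card_product, he, Finset.card_univ]

/-- The pairs of `(r+1)`-sets sharing `r` elements, at least one of which belongs to `W`. -/
def conflictPairs (r : ℕ) (W : Finset (Finset V)) : Finset (Finset V × Finset V) :=
  ((Finset.univ.powersetCard (r + 1)) ×ˢ (Finset.univ.powersetCard (r + 1))).filter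
    fun x => x.1 ≠ x.2 ∧ r ≤ (x.1 ∩ x.2).card ∧ (x.1 ∈ W ∨ x.2 ∈ W)

theorem mem_conflictPairs {W : Finset (Finset V)} {e f : Finset V} :
    (e, f) ∈ conflictPairs r W ↔ (e.card = r + 1 ∧ f.card = r + 1) ∧ e ≠ f ∧
      r ≤ (e ∩ f).card ∧ (e ∈ W ∨ f ∈ W) := by
  simp [conflictPairs]

theorem card_conflictPairs_le {W : Finset (Finset V)}
    (hW : ∀ e ∈ W, e.card = r + 1) :
    (conflictPairs r W).card ≤ 2 * ((r + 1) * Fintype.card V) * W.card := by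
  have hsub : conflictPairs r W ⊆ W.biUnion fun e =>
      (conflicts r e).image (fun f => (e, f)) ∪ (conflicts r e).image (fun f => (f, e)) := by
    rintro ⟨e, f⟩ h
    obtain ⟨⟨he, hf⟩, hne, hr, heW | hfW⟩ := mem_conflictPairs.1 h
    · refine Finset.mem_biUnion.2 ⟨e, heW, Finset.mem_union_left _ ?_⟩
      simp [conflicts, hf, hne, hr]
    · refine Finset.mem_biUnion.2 ⟨f, hfW, Finset.mem_union_right _ ?_⟩
      simp [conflicts, he, hne.symm, Finset.inter_comm f e, hr]
  rw [mul_comm]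
  refine (Finset.card_le_card hsub).trans (Finset.card_biUnion_le_card_mul _ _ _ fun e he => ?_)
  have hcard := card_conflicts_le (hW e he)
  rw [two_mul]
  exact (Finset.card_union_le _ _).trans
    (add_le_add (Finset.card_image_le.trans hcard) (Finset.card_image_le.trans hcard))

end Conflicts

section Obstructions

open MeasureTheory ProbabilityTheory unitInterval

variable {r k : ℕ} {V : Type*}

/-- The index set for the obstructions to a family of `(r+1)`-sets being a partial Steiner system
that meets every `k`-set: two conflicting `(r+1)`-sets in the family, or a `k`-set containing no
member of the family. -/
abbrev Obstruction (V : Type*) := (Finset V × Finset V) ⊕ Finset V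

/-- The `(r+1)`-sets on which an obstruction depends. -/
def Obstruction.support [DecidableEq V] (r : ℕ) : Obstruction V → Finset (Finset V)
  | .inl x => {x.1, x.2}
  | .inr K => K.powersetCard (r + 1)

/-- The families of `(r+1)`-sets in which an obstruction is present. -/
def Obstruction.event [DecidableEq V] (r : ℕ) : Obstruction V → Set (Set (Finset V))
  | .inl x => {E | ↑(Obstruction.support r (.inl x)) ⊆ E}
  | .inr K => {E | Disjoint E ↑(Obstruction.support r (.inr K))}

/-- The weight of an obstruction in the local lemma: four times the probability `p ^ 2` of a
conflict, and `1 / (2 * M)` for each of the `M` sets of size `k`. -/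
noncomputable def Obstruction.weight (p : ℝ) (M : ℕ) : Obstruction V → ℝ
  | .inl _ => 4 * p ^ 2
  | .inr _ => 1 / (2 * M)

/-- The obstructions that may depend on members of `W`. All `k`-sets are included, since they need
not be sparse. -/
def Obstruction.neighbors [DecidableEq V] [Fintype V] (r k : ℕ) (W : Finset (Finset V)) :
    Finset (Obstruction V) :=
  (conflictPairs r W).disjSum (Finset.univ.powersetCard k)

namespace Obstruction

theorem weight_nonneg (p : ℝ) (M : ℕ) (i : Obstruction V) : 0 ≤ weight p M i := by
  rcases i with _ | _ <;> simp only [weight] <;> positivity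

theorem weight_lt_one {p : ℝ} (hp0 : 0 ≤ p) (hp32 : 32 * p ≤ 1) (M : ℕ) (i : Obstruction V) :
    weight p M i < 1 := by
  rcases i with _ | _
  · simp only [weight]
    nlinarith
  · rcases M.eq_zero_or_pos with rfl | hM
    · simp [weight]
    · have : (1 : ℝ) ≤ M := by exact_mod_cast hM
      simp only [weight]
      rw [div_lt_one (by positivity)]
      linarith

variable [DecidableEq V]

theorem decidedBy_event (i : Obstruction V) : DecidedBy (i.event r) (i.support r) := by
  rcases i with _ | _
  · exact decidedBy_setOf_subset _
  · exact decidedBy_setOf_disjoint _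

theorem measureReal_event_inl {p : I} {e f : Finset V} (he : e.card = r + 1) (hf : f.card = r + 1)
    (hne : e ≠ f) :
    (setBernoulli {e : Finset V | e.card = r + 1} p).real (event r (.inl (e, f))) = p ^ 2 := by
  rw [← Finset.card_pair hne]
  exact measureReal_setBernoulli_superset (s := {e, f}) (by simp [Set.insert_subset_iff, he, hf])

theorem measureReal_event_inr {p : I} (K : Finset V) :
    (setBernoulli {e : Finset V | e.card = r + 1} p).real (event r (.inr K)) =
      (1 - p) ^ K.card.choose (r + 1) := by
  rw [← Finset.card_powersetCard]
  exact measureReal_setBernoulli_disjoint fun e he => (Finset.mem_powersetCard.1 he).2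

variable [Fintype V]

theorem disjoint_support_of_notMem_neighbors {W : Finset (Finset V)} {j : Obstruction V}
    (hj : j ∈ neighbors r k Finset.univ) (hjW : j ∉ neighbors r k W) :
    Disjoint W (j.support r) := by
  rcases j with ⟨e, f⟩ | K
  · simp only [neighbors, Finset.inl_mem_disjSum, mem_conflictPairs] at hj hjW
    simp only [support, Finset.disjoint_insert_right, Finset.disjoint_singleton_right]
    tauto
  · exact absurd (by simpa [neighbors] using hj) hjW

theorem measureReal_event_inter_avoiding {p : I} (i : Obstruction V) {T : Finset (Obstruction V)}
    (hT : T ⊆ neighbors r k Finset.univ) (hdisj : Disjoint T (neighbors r k (i.support r))) :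
    (setBernoulli {e : Finset V | e.card = r + 1} p).real (i.event r ∩ avoiding (event r) T) =
      (setBernoulli {e : Finset V | e.card = r + 1} p).real (i.event r) *
        (setBernoulli {e : Finset V | e.card = r + 1} p).real (avoiding (event r) T) :=
  measureReal_setBernoulli_inter_of_disjoint (decidedBy_event i)
    (decidedBy_avoiding fun j _ => decidedBy_event j)
    ((Finset.disjoint_biUnion_right _ _ _).2 fun _ hj =>
      disjoint_support_of_notMem_neighbors (hT hj) (Finset.disjoint_left.1 hdisj hj))

theorem le_prod_one_sub_weight {p : ℝ} (hp0 : 0 ≤ p) (hp32 : 32 * p ≤ 1)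
    (hp : 32 * (r + 1) * Fintype.card V * p = 1) {W : Finset (Finset V)}
    (hW : ∀ e ∈ W, e.card = r + 1) :
    (1 - p / 4) ^ W.card * (1 / 2) ≤
      ∏ j ∈ neighbors r k W, (1 - weight p ((Fintype.card V).choose k) j) := by
  have hpow : (1 - p / 4) ^ W.card ≤ (1 - 4 * p ^ 2) ^ (conflictPairs r W).card := by
    have hbernoulli : 1 - p / 4 ≤ (1 - 4 * p ^ 2) ^ (2 * ((r + 1) * Fintype.card V)) := by
      rw [sub_eq_add_neg 1 (4 * p ^ 2)]
      refine le_trans (le_of_eq ?_) (one_add_mul_le_pow (by nlinarith) _)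
      push_cast
      linear_combination (p / 4) * hp
    calc (1 - p / 4) ^ W.card ≤ ((1 - 4 * p ^ 2) ^ (2 * ((r + 1) * Fintype.card V))) ^ W.card :=
          pow_le_pow_left₀ (by linarith) hbernoulli _
      _ = (1 - 4 * p ^ 2) ^ (2 * ((r + 1) * Fintype.card V) * W.card) := (pow_mul _ _ _).symm
      _ ≤ (1 - 4 * p ^ 2) ^ (conflictPairs r W).card :=
          pow_le_pow_of_le_one (by nlinarith) (by nlinarith) (card_conflictPairs_le hW)
  simp only [neighbors, weight, Finset.prod_disjSum, Finset.prod_const, Finset.card_powersetCard,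
    Finset.card_univ]
  exact mul_le_mul hpow (half_le_one_sub_one_div_two_mul_pow _) (by norm_num)
    (pow_nonneg (by nlinarith) _)

theorem measureReal_event_le {p : I} (hp32 : 32 * (p : ℝ) ≤ 1)
    (hk : 4 * ((Fintype.card V).choose k : ℝ) * (1 - p / 2) ^ (k.choose (r + 1)) ≤ 1)
    {i : Obstruction V} (hi : i ∈ neighbors r k Finset.univ) :
    (setBernoulli {e : Finset V | e.card = r + 1} p).real (i.event r) ≤
      weight p ((Fintype.card V).choose k) i *
        ((1 - (p : ℝ) / 4) ^ (i.support r).card * (1 / 2)) := by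
  set M := (Fintype.card V).choose k
  have hp0 : (0 : ℝ) ≤ p := p.2.1
  rcases i with ⟨e, f⟩ | K
  · obtain ⟨⟨he, hf⟩, hne, -⟩ := mem_conflictPairs.1 (Finset.inl_mem_disjSum.1 hi)
    rw [measureReal_event_inl he hf hne]
    simp only [support, weight, Finset.card_pair hne]
    have : (1 : ℝ) / 2 ≤ (1 - p / 4) ^ 2 := by nlinarith
    nlinarith [sq_nonneg (p : ℝ)]
  · have hK : K.card = k := (Finset.mem_powersetCard.1 (Finset.inr_mem_disjSum.1 hi)).2
    have hM0 : (0 : ℝ) < M := by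
      exact_mod_cast Nat.choose_pos (hK ▸ K.card_le_univ)
    rw [measureReal_event_inr, hK]
    simp only [support, weight, Finset.card_powersetCard, hK]
    calc (1 - (p : ℝ)) ^ k.choose (r + 1)
        ≤ ((1 - p / 2) * (1 - p / 4)) ^ k.choose (r + 1) :=
          pow_le_pow_left₀ (by linarith) (by nlinarith) _
      _ = (1 - (p : ℝ) / 2) ^ k.choose (r + 1) * (1 - (p : ℝ) / 4) ^ k.choose (r + 1) :=
          mul_pow _ _ _
      _ ≤ 1 / (4 * M) * (1 - (p : ℝ) / 4) ^ k.choose (r + 1) := by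
          refine mul_le_mul_of_nonneg_right ?_ (pow_nonneg (by linarith) _)
          rw [le_div_iff₀ (by positivity)]
          linarith
      _ = 1 / (2 * M) * ((1 - (p : ℝ) / 4) ^ k.choose (r + 1) * (1 / 2)) := by ring

theorem card_eq_of_mem_support {i : Obstruction V} (hi : i ∈ neighbors r k Finset.univ)
    {e : Finset V} (he : e ∈ i.support r) : e.card = r + 1 := by
  rcases i with ⟨f, g⟩ | K
  · obtain ⟨⟨hf, hg⟩, -⟩ := mem_conflictPairs.1 (Finset.inl_mem_disjSum.1 hi)
    rcases Finset.mem_insert.1 he with rfl | he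
    · exact hf
    · rwa [Finset.mem_singleton.1 he]
  · exact (Finset.mem_powersetCard.1 he).2

theorem nonempty_avoiding {p : I} (hp : 32 * (r + 1) * Fintype.card V * (p : ℝ) = 1)
    (hk : 4 * ((Fintype.card V).choose k : ℝ) * (1 - p / 2) ^ (k.choose (r + 1)) ≤ 1) :
    (avoiding (event r) (neighbors r k (Finset.univ : Finset (Finset V)))).Nonempty := by
  set M := (Fintype.card V).choose k
  have hp0 : (0 : ℝ) ≤ p := p.2.1
  have hV : (1 : ℝ) ≤ Fintype.card V := by
    refine Nat.one_le_cast.2 (Nat.one_le_iff_ne_zero.2 fun h => ?_)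
    simp [h] at hp
  have hp32 : 32 * (p : ℝ) ≤ 1 := by
    rw [← hp]
    have : (1 : ℝ) ≤ (r + 1) * Fintype.card V := by nlinarith [r.cast_nonneg (α := ℝ)]
    nlinarith
  have hpos : 0 < ∏ i ∈ neighbors r k (Finset.univ : Finset (Finset V)), (1 - weight p M i) :=
    Finset.prod_pos fun i _ => sub_pos.2 (weight_lt_one hp0 hp32 M i)
  refine nonempty_of_measureReal_ne_zero (μ := setBernoulli {e : Finset V | e.card = r + 1} p)
    (hpos.trans_le ?_).ne'
  exact prod_le_measureReal_avoiding (fun _ => .of_discrete) (weight_nonneg _ M)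
    (fun i => (weight_lt_one hp0 hp32 M i).le)
    (fun i _ T hT hdisj => (measureReal_event_inter_avoiding i hT hdisj).le)
    fun i hi => (measureReal_event_le hp32 hk hi).trans (mul_le_mul_of_nonneg_left
      (le_prod_one_sub_weight hp0 hp32 hp fun _ => card_eq_of_mem_support hi)
      (weight_nonneg _ M i))

end Obstruction

theorem mem_ofSet_edges [Fintype V] {E : Set (Finset V)} {e : Finset V} :
    e ∈ (ofSet k E).edges ↔ e.card = k ∧ e ∈ E := by
  simp [ofSet]

theorem exists_isPartialSteiner_of_choose_mul_pow_le [DecidableEq V] [Fintype V] {p : I}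
    (hp : 32 * (r + 1) * Fintype.card V * (p : ℝ) = 1)
    (hk : 4 * ((Fintype.card V).choose k : ℝ) * (1 - p / 2) ^ (k.choose (r + 1)) ≤ 1) :
    ∃ S : KGraph (r + 1) V, S.IsPartialSteiner ∧ S.indepNum < k := by
  obtain ⟨E, hE⟩ := Obstruction.nonempty_avoiding hp hk
  refine ⟨ofSet (r + 1) E, fun R hR => Finset.card_le_one.2 fun e he f hf => ?_,
    not_le.1 fun hle => ?_⟩
  · obtain ⟨he, hRe⟩ := Finset.mem_filter.1 he
    obtain ⟨hf, hRf⟩ := Finset.mem_filter.1 hf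
    rw [mem_ofSet_edges] at he hf
    by_contra hne
    have hr : r ≤ (e ∩ f).card :=
      hR.symm.trans_le (Finset.card_le_card (Finset.subset_inter hRe hRf))
    refine hE (.inl (e, f)) (Finset.inl_mem_disjSum.2 (mem_conflictPairs.2
      ⟨⟨he.1, hf.1⟩, hne, hr, Or.inl (Finset.mem_univ e)⟩)) ?_
    simp [Obstruction.event, Obstruction.support, Set.insert_subset_iff, he.2, hf.2]
  · obtain ⟨K, hK, hKcard⟩ := exists_isIndep_of_le_indepNum _ hle
    refine hE (.inr K) (by simp [Obstruction.neighbors, hKcard])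
      (Set.disjoint_left.2 fun e heE he => ?_)
    obtain ⟨hsub, hcard⟩ := Finset.mem_powersetCard.1 (Finset.mem_coe.1 he)
    exact hK e (mem_ofSet_edges.2 ⟨hcard, heE⟩) hsub

end Obstructions

end KGraph

section Binomial

theorem choose_le_exp_mul_log (n k : ℕ) : (n.choose k : ℝ) ≤ Real.exp (k * Real.log n) := by
  rcases n.eq_zero_or_pos with rfl | hn
  · rcases k with _ | k <;> simp
  · rw [Real.exp_nat_mul, Real.exp_log (by exact_mod_cast hn)]
    exact_mod_cast Nat.choose_le_pow n k

theorem choose_mul_one_sub_pow_le_exp {n k j : ℕ} {q : ℝ} (hq : q ≤ 1) :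
    n.choose k * (1 - q) ^ j ≤ Real.exp (k * Real.log n - q * j) := by
  have hpow : (1 - q) ^ j ≤ Real.exp (-(q * j)) := by
    rw [← neg_mul, mul_comm, Real.exp_nat_mul]
    exact pow_le_pow_left₀ (by linarith) (Real.one_sub_le_exp_neg q) j
  rw [sub_eq_add_neg (k * Real.log n), Real.exp_add]
  exact mul_le_mul (choose_le_exp_mul_log n k) hpow (pow_nonneg (by linarith) _) (Real.exp_pos _).le

theorem one_sub_mul_pow_le_factorial_mul_choose {r k : ℕ} (hrk : r ≤ k) :
    (1 - (r + 1) * r / k) * (k : ℝ) ^ (r + 1) ≤ (r + 1).factorial * k.choose (r + 1) := by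
  rcases k.eq_zero_or_pos with rfl | hk
  · simp
  have hk0 : (0 : ℝ) < k := by exact_mod_cast hk
  have hle : (r : ℝ) / k ≤ 1 := (div_le_one hk0).2 (by exact_mod_cast hrk)
  have hbernoulli := one_add_mul_le_pow (a := -((r : ℝ) / k)) (by linarith) (r + 1)
  have hchoose := Nat.pow_le_choose (α := ℝ) (r + 1) k
  rw [div_le_iff₀ (by positivity), Nat.add_sub_add_right, Nat.cast_sub hrk] at hchoose
  calc (1 - (r + 1) * r / k) * (k : ℝ) ^ (r + 1)
      = (1 + ((r + 1 : ℕ) : ℝ) * -(r / k)) * (k : ℝ) ^ (r + 1) := by push_cast; ring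
    _ ≤ (1 + -((r : ℝ) / k)) ^ (r + 1) * (k : ℝ) ^ (r + 1) := by gcongr
    _ = ((k : ℝ) - r) ^ (r + 1) := by rw [← mul_pow]; congr 1; field_simp; ring
    _ ≤ (r + 1).factorial * k.choose (r + 1) := by linarith

theorem mul_le_mul_choose {r k : ℕ} (hr : r ≠ 0) {ε L q : ℝ} (hε : 0 < ε) (hL : 0 ≤ L)
    (hq : 0 < q) (hk : 2 * (r + 1) * r * (1 + ε) / ε ≤ k)
    (hkx : (1 + ε) * ((r + 1).factorial : ℝ) ^ (1 / (r : ℝ)) * (L / q) ^ (1 / (r : ℝ)) ≤ k) :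
    (1 + ε / 2) * (k * L) ≤ q * k.choose (r + 1) := by
  have hr1 : (1 : ℝ) ≤ r := by exact_mod_cast Nat.one_le_iff_ne_zero.2 hr
  have hk0 : (0 : ℝ) < k := lt_of_lt_of_le (by positivity) hk
  rw [div_le_iff₀ hε] at hk
  have hrk : r ≤ k := by
    have hle : (r : ℝ) * ε ≤ k * ε := by
      nlinarith [mul_nonneg (by positivity : (0 : ℝ) ≤ r * r) hε.le]
    exact_mod_cast le_of_mul_le_mul_right hle hε
  set η : ℝ := (r + 1) * r / k with hη
  have hηε : η * (1 + ε) ≤ ε / 2 := by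
    rw [hη, div_mul_eq_mul_div, div_le_iff₀ hk0]
    linarith
  have hη1 : 0 ≤ 1 - η := by nlinarith
  have hpow : (1 + ε) ^ r * ((r + 1).factorial * (L / q)) ≤ (k : ℝ) ^ r := by
    have := pow_le_pow_left₀ (by positivity) hkx r
    rwa [mul_pow, mul_pow, one_div, Real.rpow_inv_natCast_pow (by positivity) hr,
      Real.rpow_inv_natCast_pow (by positivity) hr, mul_assoc] at this
  have hcoeff : 1 + ε / 2 ≤ (1 - η) * (1 + ε) ^ r :=
    calc 1 + ε / 2 ≤ (1 - η) * (1 + ε) := by linarith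
      _ ≤ (1 - η) * (1 + ε) ^ r :=
        mul_le_mul_of_nonneg_left (le_self_pow₀ (by linarith) hr) hη1
  refine le_of_mul_le_mul_left ?_ (show (0 : ℝ) < (r + 1).factorial by positivity)
  calc (r + 1).factorial * ((1 + ε / 2) * (k * L))
      ≤ (r + 1).factorial * ((1 - η) * (1 + ε) ^ r * (k * L)) := by gcongr
    _ = q * ((1 - η) * ((1 + ε) ^ r * ((r + 1).factorial * (L / q)) * k)) := by field_simp
    _ ≤ q * ((1 - η) * ((k : ℝ) ^ r * k)) := by gcongr
    _ ≤ q * ((r + 1).factorial * k.choose (r + 1)) := by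
        rw [← pow_succ]
        exact mul_le_mul_of_nonneg_left (one_sub_mul_pow_le_factorial_mul_choose hrk) hq.le
    _ = (r + 1).factorial * (q * k.choose (r + 1)) := by ring

theorem rpow_one_div_le_mul_rpow_of_le_mul {r : ℕ} (hr : r ≠ 0) {C x y : ℝ} (hC : 1 ≤ C)
    (hx : 0 ≤ x) (hxy : x ≤ C * y) : x ^ (1 / (r : ℝ)) ≤ C * y ^ (1 / (r : ℝ)) := by
  have hy : 0 ≤ y := by nlinarith
  have hr1 : 1 / (r : ℝ) ≤ 1 := by
    simpa using Nat.cast_inv_le_one r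
  calc x ^ (1 / (r : ℝ)) ≤ (C * y) ^ (1 / (r : ℝ)) :=
        Real.rpow_le_rpow hx hxy (by positivity)
    _ = C ^ (1 / (r : ℝ)) * y ^ (1 / (r : ℝ)) := Real.mul_rpow (by linarith) hy
    _ ≤ C * y ^ (1 / (r : ℝ)) := by
        gcongr
        simpa using Real.rpow_le_rpow_of_exponent_le hC hr1

end Binomial

namespace KGraph

section SteinerSystems

theorem four_mul_choose_mul_pow_le_one {r m k : ℕ} (hr : r ≠ 0) (hm : 3 ≤ m) {p : ℝ}
    (hp : 32 * (r + 1) * m * p = 1) (hk : 4 * ((r : ℝ) + 1) * r ≤ k)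
    (hkx : 2 * (((r + 1).factorial : ℝ) * (128 * (r + 1))) ^ (1 / (r : ℝ)) *
      ((m : ℝ) * Real.log m) ^ (1 / (r : ℝ)) ≤ k) :
    4 * (m.choose k : ℝ) * (1 - p / 2) ^ (k.choose (r + 1)) ≤ 1 := by
  have hm3 : (3 : ℝ) ≤ m := by exact_mod_cast hm
  have hr1 : (1 : ℝ) ≤ r := by exact_mod_cast Nat.one_le_iff_ne_zero.2 hr
  have hlog : 1 ≤ Real.log m := by
    rw [Real.le_log_iff_exp_le (by linarith)]
    linarith [Real.exp_one_lt_d9]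
  have hpeq : p = (32 * ((r : ℝ) + 1) * m)⁻¹ := eq_inv_of_mul_eq_one_right hp
  have hp0 : 0 < p := by rw [hpeq]; positivity
  have hp1 : p ≤ 1 := by rw [hpeq]; exact inv_le_one_of_one_le₀ (by nlinarith)
  have hL : Real.log m / (p / 4) = 128 * (r + 1) * (m * Real.log m) := by
    rw [hpeq]
    field_simp
    norm_num
  have hchoose : (1 + 1 / 2) * (k * Real.log m) ≤ p / 4 * k.choose (r + 1) := by
    refine mul_le_mul_choose hr one_pos (by linarith) (by positivity) (by linarith) ?_
    rwa [hL, Real.mul_rpow (x := 128 * ((r : ℝ) + 1)) (by positivity) (by positivity), ← mul_assoc,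
      mul_assoc (1 + 1 : ℝ), ← Real.mul_rpow (by positivity) (by positivity), one_add_one_eq_two]
  have hexp := choose_mul_one_sub_pow_le_exp (n := m) (k := k) (j := k.choose (r + 1))
    (q := p / 2) (by linarith)
  have hklog : 8 ≤ k * Real.log m := by nlinarith
  have hfour : (4 : ℝ) ≤ Real.exp (2 * (k * Real.log m)) := by
    linarith [Real.add_one_le_exp (2 * (k * Real.log m))]
  calc 4 * (m.choose k : ℝ) * (1 - p / 2) ^ (k.choose (r + 1))
      ≤ 4 * Real.exp (k * Real.log m - p / 2 * k.choose (r + 1)) := by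
        rw [mul_assoc]
        gcongr
    _ ≤ Real.exp (2 * (k * Real.log m)) * Real.exp (-(2 * (k * Real.log m))) := by
        gcongr
        linarith
    _ = 1 := by rw [← Real.exp_add, add_neg_cancel, Real.exp_zero]

theorem edges_nonempty_of_maxDegree_pos {r : ℕ} {V : Type*} [Fintype V] [DecidableEq V]
    {H : KGraph (r + 1) V} (h : 0 < H.maxDegree) : H.edges.Nonempty := by
  contrapose! h
  exact maxDegree_le_iff.2 fun R _ => by simp [degree, h]

theorem exists_isPartialSteiner_indepNum_le {r : ℕ} (hr : 2 ≤ r) :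
    ∃ a : ℝ, 0 < a ∧ ∀ m : ℕ, r + 1 ≤ m → ∃ S : KGraph (r + 1) (Fin m), S.IsPartialSteiner ∧
      S.edges.Nonempty ∧ (S.indepNum : ℝ) ≤ a * ((m : ℝ) * Real.log m) ^ (1 / (r : ℝ)) := by
  set C : ℝ := (((r + 1).factorial : ℝ) * (128 * (r + 1))) ^ (1 / (r : ℝ)) with hC
  refine ⟨2 * C + 4 * (r + 1) * r, by positivity, fun m hm => ?_⟩
  set y := ((m : ℝ) * Real.log m) ^ (1 / (r : ℝ)) with hy
  have hm3 : (3 : ℝ) ≤ m := by exact_mod_cast (by omega : 3 ≤ m)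
  have hlog : 1 ≤ Real.log m := by
    rw [Real.le_log_iff_exp_le (by linarith)]
    linarith [Real.exp_one_lt_d9]
  have hy1 : 1 ≤ y := Real.one_le_rpow (by nlinarith) (by positivity)
  set k := ⌊(2 * C + 4 * (r + 1) * r) * y⌋₊ + 1 with hk
  have hky : (2 * C + 4 * (r + 1) * r) * y ≤ k := by
    rw [hk]
    exact_mod_cast (Nat.lt_floor_add_one _).le
  set p : unitInterval := ⟨(32 * (r + 1) * m)⁻¹, by positivity, inv_le_one_of_one_le₀ (by
    nlinarith [r.cast_nonneg (α := ℝ)])⟩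
  have hp : 32 * (r + 1) * m * (p : ℝ) = 1 := mul_inv_cancel₀ (by positivity)
  have hfirst : 4 * (m.choose k : ℝ) * (1 - p / 2) ^ (k.choose (r + 1)) ≤ 1 := by
    have hCy : 0 ≤ C * y := by positivity
    have hry : 4 * ((r : ℝ) + 1) * r ≤ 4 * ((r : ℝ) + 1) * r * y :=
      le_mul_of_one_le_right (by positivity) hy1
    refine four_mul_choose_mul_pow_le_one (by omega) (by omega) hp (by linarith) ?_
    rw [← hC, ← hy]
    linarith [hry.trans' (by positivity : (0 : ℝ) ≤ 4 * (r + 1) * r)]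
  obtain ⟨S, hS, hα⟩ := exists_isPartialSteiner_of_choose_mul_pow_le (V := Fin m) (p := p)
    (by rwa [Fintype.card_fin]) (by rwa [Fintype.card_fin])
  obtain ⟨S', hsub, hdeg⟩ := exists_edges_subset_maxDegree_eq S (maxDegree_le_iff.2 hS)
    (by rw [Fintype.card_fin]; omega)
  refine ⟨S', maxDegree_le_iff.1 hdeg.le, edges_nonempty_of_maxDegree_pos (by omega), ?_⟩
  have hle : S'.indepNum ≤ ⌊(2 * C + 4 * (r + 1) * r) * y⌋₊ :=
    (indepNum_le_of_edges_subset hsub).trans (Nat.lt_succ_iff.1 hα)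
  exact (Nat.le_floor_iff (by positivity)).1 hle

theorem exists_isPartialSteiner_indepNum_blowup_le {r : ℕ} (hr : 2 ≤ r) :
    ∃ a b : ℝ, 0 < a ∧ 0 < b ∧ ∀ m : ℕ, r + 1 ≤ m →
      ∃ S : KGraph (r + 1) (Fin m), S.IsPartialSteiner ∧
        (S.indepNum : ℝ) ≤ a * ((m : ℝ) * Real.log m) ^ (1 / (r : ℝ)) ∧
        ∀ d N : ℕ, 1 ≤ d → N = m * d →
          (S.blowup d).maxDegree = d ∧
          ((S.blowup d).indepNum : ℝ)
            ≤ b * ((N : ℝ) / d * Real.log ((N : ℝ) / d)) ^ (1 / (r : ℝ)) := by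
  obtain ⟨a, ha, hSteiner⟩ := exists_isPartialSteiner_indepNum_le hr
  refine ⟨a, r * a, ha, by positivity, fun m hm => ?_⟩
  obtain ⟨S, hS, hne, hα⟩ := hSteiner m hm
  refine ⟨S, hS, hα, fun d N hd hN => ⟨maxDegree_blowup hr hS hne, ?_⟩⟩
  have hNd : (N : ℝ) / d = m := by
    rw [hN, Nat.cast_mul, mul_div_cancel_right₀ _ (by positivity)]
  rw [hNd, indepNum_blowup, Nat.cast_mul, mul_assoc]
  gcongr
  exact min_le_left r d

theorem exists_maxDegree_eq_indepNum_le {r : ℕ} (hr : 2 ≤ r) :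
    ∃ b : ℝ, 0 < b ∧ ∀ d n : ℕ, 1 ≤ d → r * d < n →
      ∃ H : KGraph (r + 1) (Fin n), H.maxDegree = d ∧
        (H.indepNum : ℝ) ≤ b * ((n : ℝ) / d * Real.log ((n : ℝ) / d)) ^ (1 / (r : ℝ)) := by
  obtain ⟨a, ha, hSteiner⟩ := exists_isPartialSteiner_indepNum_le hr
  have hr0 : (0 : ℝ) < r := by exact_mod_cast (by omega : 0 < r)
  refine ⟨r * (a * 4), by positivity, fun d n hd hn => ?_⟩
  set m := ⌈(n : ℝ) / d⌉₊ with hm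
  set y : ℝ := (n : ℝ) / d with hy
  have hd0 : (0 : ℝ) < d := by exact_mod_cast hd
  have hry : (r : ℝ) < y := by
    rw [hy, lt_div_iff₀ hd0]
    exact_mod_cast hn
  have hy2 : 2 ≤ y := hry.le.trans' (by exact_mod_cast hr)
  have hym : y ≤ m := Nat.le_ceil y
  have hnm : n ≤ m * d := by
    rw [hy, div_le_iff₀ hd0] at hym
    exact_mod_cast hym
  have hm2 : (m : ℝ) ≤ 2 * y := by linarith [Nat.ceil_lt_add_one (by linarith : 0 ≤ y)]
  have hlog : Real.log m ≤ 2 * Real.log y := by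
    refine (Real.log_le_log (by linarith) hm2).trans ?_
    rw [Real.log_mul (by norm_num) (by linarith), two_mul]
    exact add_le_add_left (Real.log_le_log (by norm_num) hy2) _
  have hmlog : (m : ℝ) * Real.log m ≤ 4 * (y * Real.log y) :=
    calc (m : ℝ) * Real.log m ≤ (2 * y) * (2 * Real.log y) :=
          mul_le_mul hm2 hlog (Real.log_natCast_nonneg m) (by linarith)
      _ = 4 * (y * Real.log y) := by ring
  obtain ⟨S, hS, -, hα⟩ := hSteiner m (Nat.lt_ceil.2 hry)
  obtain ⟨H, hH, hHα⟩ := exists_maxDegree_eq_of_isPartialSteiner hr hS (n := n) (d := d)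
    (by rwa [Fintype.card_fin]) (by nlinarith)
  refine ⟨H, hH, ?_⟩
  calc (H.indepNum : ℝ) ≤ r * S.indepNum := by exact_mod_cast hHα
    _ ≤ r * (a * (4 * (y * Real.log y) ^ (1 / (r : ℝ)))) := by
        gcongr
        refine hα.trans ?_
        gcongr
        exact rpow_one_div_le_mul_rpow_of_le_mul (by omega) (by norm_num)
          (mul_nonneg m.cast_nonneg (Real.log_natCast_nonneg m)) hmlog
    _ = r * (a * 4) * (y * Real.log y) ^ (1 / (r : ℝ)) := by ring

end SteinerSystems

section RandomGraph

open MeasureTheory ProbabilityTheory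

variable {n k r d : ℕ} {p : unitInterval}

theorem coe_edgeProb (hn : d + r ≤ n) : (edgeProb n r d : ℝ) = (d : ℝ) / ((n : ℝ) - r) := by
  have hle : (d : ℝ) ≤ n - r := le_sub_iff_add_le.2 (by exact_mod_cast hn)
  have hnr : (0 : ℝ) ≤ n - r := d.cast_nonneg.trans hle
  rw [edgeProb, Set.projIcc_of_mem]
  exact ⟨div_nonneg d.cast_nonneg hnr, div_le_one_of_le₀ hle hnr⟩

theorem edgeProb_mul_sub (hn : d + r ≤ n) : (edgeProb n r d : ℝ) * (n - r : ℕ) = d := by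
  rw [coe_edgeProb hn, Nat.cast_sub (by omega)]
  refine div_mul_cancel_of_imp fun hnr => ?_
  rw [sub_eq_zero, Nat.cast_inj] at hnr
  exact_mod_cast (by omega : d = 0)

theorem randomProb_le_one (A : KGraph k (Fin n) → Prop) : randomProb n k p A ≤ 1 :=
  measureReal_le_one

theorem randomProb_mono {A B : KGraph k (Fin n) → Prop} (h : ∀ H, A H → B H) :
    randomProb n k p A ≤ randomProb n k p B :=
  measureReal_mono fun _ hE => h _ hE

theorem exists_of_randomProb_pos {A : KGraph k (Fin n) → Prop} (h : 0 < randomProb n k p A) :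
    ∃ H, A H := by
  by_contra! hA
  simp [randomProb, hA] at h

theorem randomProb_exists_le_sum {ι : Type*} (s : Finset ι) (A : ι → KGraph k (Fin n) → Prop) :
    randomProb n k p (fun H => ∃ i ∈ s, A i H) ≤ ∑ i ∈ s, randomProb n k p (A i) := by
  refine (measureReal_mono (fun E hE => ?_) (measure_ne_top _ _)).trans
    (measureReal_biUnion_finset_le s fun i => {E | A i (ofSet k E)})
  simpa using hE

theorem one_sub_add_le_randomProb_and (A B : KGraph k (Fin n) → Prop) :
    1 - (randomProb n k p (fun H => ¬ A H) + randomProb n k p (fun H => ¬ B H)) ≤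
      randomProb n k p (fun H => A H ∧ B H) := by
  have hcover : (Set.univ : Set (Set (Finset (Fin n)))) ⊆
      {E | A (ofSet k E) ∧ B (ofSet k E)} ∪ ({E | ¬ A (ofSet k E)} ∪ {E | ¬ B (ofSet k E)}) :=
    fun E _ => by
      by_cases hA : A (ofSet k E) <;> by_cases hB : B (ofSet k E) <;> simp [hA, hB]
  have hone := (measureReal_mono hcover (μ := setBernoulli {e | e.card = k} p)).trans
    ((measureReal_union_le _ _).trans (add_le_add_right (measureReal_union_le _ _) _))
  rw [probReal_univ] at hone
  unfold randomProb
  linarith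

theorem degree_ofSet_univ {V : Type*} [Fintype V] [DecidableEq V] {R : Finset V}
    (hR : R.card = r) :
    (ofSet (r + 1) Set.univ : KGraph (r + 1) V).degree R = Fintype.card V - r := by
  have hlink : (ofSet (r + 1) Set.univ : KGraph (r + 1) V).link R = Rᶜ := by
    ext v
    simp +contextual [mem_link, mem_ofSet_edges, hR]
  rw [degree_eq_card_link _ hR, hlink, Finset.card_compl, hR]

theorem randomProb_degree_deviation_le {R : Finset (Fin n)} (hR : R.card = r) {δ : ℝ}
    (hδ : 0 ≤ δ) (hδ1 : δ ≤ 1) :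
    randomProb n (r + 1) p
        (fun H => δ * (p * (n - r : ℕ)) ≤ |(H.degree R : ℝ) - p * (n - r : ℕ)|) ≤
      2 * Real.exp (-(δ ^ 2 / 4 * (p * (n - r : ℕ)))) := by
  classical
  set s := (ofSet (r + 1) (Set.univ : Set (Finset (Fin n)))).edges.filter (R ⊆ ·) with hs
  set μ : Measure (Set (Finset (Fin n))) := setBernoulli {e | e.card = r + 1} p
  set X : Finset (Fin n) → Set (Finset (Fin n)) → ℝ := fun e E => if e ∈ E then 1 else 0
  have hindep : iIndepFun X μ :=
    iIndepFun_mem_setBernoulli.comp (fun _ P => if P then 1 else 0) fun _ => .of_discrete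
  have hmeas (e) : Measurable (X e) :=
    (Measurable.of_discrete (f := fun P : Prop => if P then (1 : ℝ) else 0)).comp
      (measurable_set_mem e)
  have hmean (e) (he : e ∈ s) : μ[X e] = (p : ℝ) := by
    rw [← measureReal_setBernoulli_mem (u := {e : Finset (Fin n) | e.card = r + 1}) (a := e)
        (mem_ofSet_edges.1 (Finset.mem_filter.1 he).1).1,
      ← integral_indicator_one (measurableSet_setOfPred.2 (measurable_set_mem e))]
    rfl
  have hsum : ∑ e ∈ s, μ[X e] = (p : ℝ) * (n - r : ℕ) := by
    rw [Finset.sum_congr rfl hmean, Finset.sum_const, nsmul_eq_mul, mul_comm,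
      ← degree, degree_ofSet_univ hR,
      Fintype.card_fin]
  have hdegree (E) : ∑ e ∈ s, X e E = (ofSet (r + 1) E).degree R := by
    rw [Finset.sum_boole, hs, Finset.filter_filter, degree]
    congr 2
    ext e
    simp [mem_ofSet_edges, and_assoc, and_comm]
  have hX01 (e E) : X e E ∈ Set.Icc (0 : ℝ) 1 := by
    by_cases he : e ∈ E <;> simp [X, he]
  simpa only [hsum, hdegree, randomProb] using
    measureReal_mul_le_abs_sum_sub_le hindep hmeas hX01 s hδ hδ1

theorem randomProb_exists_degree_deviation_le {δ : ℝ} (hδ : 0 ≤ δ) (hδ1 : δ ≤ 1) :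
    randomProb n (r + 1) p (fun H => ∃ R ∈ (Finset.univ : Finset (Fin n)).powersetCard r,
        δ * (p * (n - r : ℕ)) ≤ |(H.degree R : ℝ) - p * (n - r : ℕ)|) ≤
      2 * Real.exp (r * Real.log n - δ ^ 2 / 4 * (p * (n - r : ℕ))) := by
  refine (randomProb_exists_le_sum _ _).trans <| (Finset.sum_le_sum fun R hR =>
    randomProb_degree_deviation_le (Finset.mem_powersetCard.1 hR).2 hδ hδ1).trans ?_
  rw [Finset.sum_const, Finset.card_powersetCard, Finset.card_univ, Fintype.card_fin,
    nsmul_eq_mul, mul_left_comm, sub_eq_add_neg, Real.exp_add]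
  gcongr
  exact choose_le_exp_mul_log n r

theorem randomProb_le_indepNum_le :
    randomProb n (r + 1) p (fun H => k ≤ H.indepNum) ≤
      Real.exp (k * Real.log n - p * k.choose (r + 1)) := by
  have hindep (K : Finset (Fin n)) (hK : K ∈ (Finset.univ : Finset (Fin n)).powersetCard k) :
      randomProb n (r + 1) p (fun H => H.IsIndep K) ≤ (1 - p) ^ k.choose (r + 1) := by
    rw [← (Finset.mem_powersetCard.1 hK).2, ← Finset.card_powersetCard,
      ← measureReal_setBernoulli_disjoint (u := {e : Finset (Fin n) | e.card = r + 1})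
        fun e he => (Finset.mem_powersetCard.1 he).2]
    refine measureReal_mono fun E hE => Set.disjoint_left.2 fun e heE heK => ?_
    have he := Finset.mem_powersetCard.1 heK
    exact hE e (mem_ofSet_edges.2 ⟨he.2, heE⟩) he.1
  calc randomProb n (r + 1) p (fun H => k ≤ H.indepNum)
      ≤ randomProb n (r + 1) p
          (fun H => ∃ K ∈ (Finset.univ : Finset (Fin n)).powersetCard k, H.IsIndep K) := by
        refine randomProb_mono fun H hH => ?_
        obtain ⟨K, hK, hcard⟩ := exists_isIndep_of_le_indepNum H hH
        exact ⟨K, by simp [hcard], hK⟩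
    _ ≤ ∑ _K ∈ (Finset.univ : Finset (Fin n)).powersetCard k, (1 - (p : ℝ)) ^ k.choose (r + 1) :=
        (randomProb_exists_le_sum _ _).trans (Finset.sum_le_sum hindep)
    _ = n.choose k * (1 - (p : ℝ)) ^ k.choose (r + 1) := by
        simp [Finset.sum_const, Finset.card_powersetCard]
    _ ≤ Real.exp (k * Real.log n - p * k.choose (r + 1)) := choose_mul_one_sub_pow_le_exp p.2.2

theorem randomProb_lt_indepNum_le (hr : r ≠ 0) (hp : 0 < (p : ℝ)) {ε x : ℝ} (hε : 0 < ε)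
    (hx : 2 * (r + 1) * r * (1 + ε) / ε ≤ x)
    (hpx : (1 + ε) * ((r + 1).factorial : ℝ) ^ (1 / (r : ℝ)) *
      (Real.log n / p) ^ (1 / (r : ℝ)) ≤ x) :
    randomProb n (r + 1) p (fun H => x < H.indepNum) ≤ Real.exp (-(ε / 2 * Real.log n)) := by
  have hlog := Real.log_natCast_nonneg n
  set k := ⌊x⌋₊ + 1 with hk
  have hxk : x ≤ k := by
    rw [hk]
    exact_mod_cast (Nat.lt_floor_add_one x).le
  have hfirst := mul_le_mul_choose hr hε hlog hp (hx.trans hxk) (hpx.trans hxk)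
  have hklog : Real.log n ≤ k * Real.log n :=
    le_mul_of_one_le_left hlog (by exact_mod_cast Nat.le_add_left 1 _)
  refine (randomProb_mono fun H hH => ?_).trans <|
    (randomProb_le_indepNum_le (k := k)).trans (Real.exp_le_exp.2 ?_)
  · exact (Nat.floor_lt (hx.trans' (by positivity))).2 hH
  · nlinarith

end RandomGraph

section Asymptotics

variable {r : ℕ} {d : ℕ → ℕ}

theorem tendsto_log_natCast_atTop : Tendsto (fun n : ℕ => Real.log n) atTop atTop :=
  Real.tendsto_log_atTop.comp tendsto_natCast_atTop_atTop

theorem tendsto_exp_neg_mul_log {c : ℝ} (hc : 0 < c) :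
    Tendsto (fun n : ℕ => Real.exp (-(c * Real.log n))) atTop (𝓝 0) :=
  Real.tendsto_exp_neg_atTop_nhds_zero.comp (tendsto_log_natCast_atTop.const_mul_atTop hc)

theorem eventually_one_le_of_log_isLittleO
    (hd : (fun n : ℕ => Real.log n) =o[atTop] (fun n : ℕ => (d n : ℝ))) :
    ∀ᶠ n in atTop, 1 ≤ d n := by
  filter_upwards [hd.bound one_pos, tendsto_log_natCast_atTop.eventually_gt_atTop 0]
    with n hn hlog
  rw [Real.norm_natCast, one_mul, Real.norm_of_nonneg hlog.le] at hn
  exact_mod_cast hlog.trans_le hn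

theorem eventually_mul_log_le_of_log_isLittleO
    (hd : (fun n : ℕ => Real.log n) =o[atTop] (fun n : ℕ => (d n : ℝ))) {c C : ℝ} (hc : 0 < c)
    (hC : 0 < C) : ∀ᶠ n : ℕ in atTop, C * Real.log n ≤ c * d n := by
  filter_upwards [hd.bound (div_pos hc hC)] with n hn
  rw [Real.norm_natCast, Real.norm_of_nonneg (Real.log_natCast_nonneg n), div_mul_eq_mul_div,
    le_div_iff₀ hC] at hn
  linarith

theorem eventually_log_le_mul_log_div (hd1 : ∀ᶠ n in atTop, 1 ≤ d n)
    (hdl : (fun n : ℕ => Real.log (d n)) =o[atTop] (fun n : ℕ => Real.log n))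
    {C : ℝ} (hC : 1 < C) :
    ∀ᶠ n : ℕ in atTop, Real.log n ≤ C * Real.log ((n : ℝ) / d n) := by
  have hinv : 0 < 1 - C⁻¹ := sub_pos.2 (inv_lt_one_of_one_lt₀ hC)
  filter_upwards [hdl.bound hinv, hd1, eventually_ge_atTop 1] with n hn hdn hn1
  have hd0 : (d n : ℝ) ≠ 0 := by exact_mod_cast Nat.one_le_iff_ne_zero.1 hdn
  have hn0 : (n : ℝ) ≠ 0 := by exact_mod_cast Nat.one_le_iff_ne_zero.1 hn1
  rw [Real.norm_of_nonneg (Real.log_natCast_nonneg n),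
    Real.norm_of_nonneg (Real.log_natCast_nonneg _)] at hn
  rw [Real.log_div hn0 hd0, ← inv_mul_le_iff₀ (by linarith)]
  linarith

theorem eventually_add_le (r : ℕ) (hd1 : ∀ᶠ n in atTop, 1 ≤ d n)
    (hdl : (fun n : ℕ => Real.log (d n)) =o[atTop] (fun n : ℕ => Real.log n)) :
    ∀ᶠ n : ℕ in atTop, d n + r ≤ n := by
  filter_upwards [eventually_log_le_mul_log_div hd1 hdl one_lt_two, hd1, eventually_ge_atTop 1,
    tendsto_log_natCast_atTop.eventually_ge_atTop (2 * Real.log (r + 1))] with n hlog hdn hn1 hr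
  have hn0 : (0 : ℝ) < n := by exact_mod_cast hn1
  have hd1 : (1 : ℝ) ≤ d n := by exact_mod_cast hdn
  have hratio : Real.log (r + 1) ≤ Real.log ((n : ℝ) / d n) := by linarith
  rw [Real.log_le_log_iff (by positivity) (div_pos hn0 (by linarith)),
    le_div_iff₀ (by linarith)] at hratio
  have hle : (d n : ℝ) + r ≤ n := by nlinarith [r.cast_nonneg (α := ℝ)]
  exact_mod_cast hle

theorem tendsto_randomProb_degree_deviation (r : ℕ)
    (hd : (fun n : ℕ => Real.log n) =o[atTop] (fun n : ℕ => (d n : ℝ)))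
    (hdn : ∀ᶠ n : ℕ in atTop, d n + r ≤ n) {ε : ℝ} (hε : 0 < ε) :
    Tendsto (fun n : ℕ => randomProb n (r + 1) (edgeProb n r (d n))
      (fun H => ¬ ∀ R : Finset (Fin n), R.card = r → |(H.degree R : ℝ) - d n| ≤ ε * d n))
      atTop (𝓝 0) := by
  set δ := min ε 1
  have hδ : 0 < δ := lt_min hε one_pos
  have hlim := (tendsto_exp_neg_mul_log one_pos).const_mul 2
  rw [mul_zero] at hlim
  refine squeeze_zero' (.of_forall fun n => MeasureTheory.measureReal_nonneg) ?_ hlim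
  filter_upwards [hdn, eventually_mul_log_le_of_log_isLittleO hd
    (show 0 < δ ^ 2 / 4 by positivity) (show (0 : ℝ) < r + 1 by positivity)] with n hn hlog
  calc _ ≤ randomProb n (r + 1) (edgeProb n r (d n))
          (fun H => ∃ R ∈ (Finset.univ : Finset (Fin n)).powersetCard r,
            δ * d n ≤ |(H.degree R : ℝ) - d n|) := by
        refine randomProb_mono fun H hH => ?_
        push Not at hH
        obtain ⟨R, hR, hlt⟩ := hH
        exact ⟨R, by simp [hR], hlt.le.trans' (by gcongr; exact min_le_left ε 1)⟩
    _ ≤ 2 * Real.exp (r * Real.log n - δ ^ 2 / 4 * d n) := by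
        simpa only [edgeProb_mul_sub hn] using randomProb_exists_degree_deviation_le
          (n := n) (r := r) (p := edgeProb n r (d n)) hδ.le (min_le_right ε 1)
    _ ≤ 2 * Real.exp (-(1 * Real.log n)) := by
        gcongr
        linarith

theorem tendsto_randomProb_lt_indepNum (hr : r ≠ 0) (hd1 : ∀ᶠ n in atTop, 1 ≤ d n)
    (hdn : ∀ᶠ n : ℕ in atTop, d n + r ≤ n) {ε : ℝ} (hε : 0 < ε) :
    Tendsto (fun n : ℕ => randomProb n (r + 1) (edgeProb n r (d n))
      (fun H => (1 + ε) * ((r + 1).factorial : ℝ) ^ (1 / (r : ℝ)) *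
        ((n : ℝ) / d n * Real.log n) ^ (1 / (r : ℝ)) < H.indepNum)) atTop (𝓝 0) := by
  have hr0 : (0 : ℝ) < r := by exact_mod_cast Nat.pos_of_ne_zero hr
  have hcoeff : 1 ≤ (1 + ε) * ((r + 1).factorial : ℝ) ^ (1 / (r : ℝ)) :=
    one_le_mul_of_one_le_of_one_le (by linarith) <| Real.one_le_rpow
      (by exact_mod_cast Nat.one_le_iff_ne_zero.2 (Nat.factorial_ne_zero _)) (by positivity)
  have hlog_rpow : Tendsto (fun n : ℕ => Real.log n ^ (1 / (r : ℝ))) atTop atTop :=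
    (tendsto_rpow_atTop (by positivity)).comp tendsto_log_natCast_atTop
  refine squeeze_zero' (.of_forall fun n => MeasureTheory.measureReal_nonneg) ?_
    (tendsto_exp_neg_mul_log (half_pos hε))
  filter_upwards [hdn, hd1, hlog_rpow.eventually_ge_atTop (2 * (r + 1) * r * (1 + ε) / ε)]
    with n hn hdn1 hlarge
  have hd0 : (0 : ℝ) < d n := by exact_mod_cast hdn1
  have hnr : (d n : ℝ) ≤ n - r := le_sub_iff_add_le.2 (by exact_mod_cast hn)
  have hlog := Real.log_natCast_nonneg n
  have hp := coe_edgeProb hn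
  have hp0 : 0 < (edgeProb n r (d n) : ℝ) := by
    rw [hp]
    exact div_pos hd0 (by linarith)
  refine randomProb_lt_indepNum_le hr hp0 hε (hlarge.trans ?_) ?_
  · refine (Real.rpow_le_rpow hlog ?_ (by positivity)).trans
      (le_mul_of_one_le_left (by positivity) hcoeff)
    exact le_mul_of_one_le_left hlog ((one_le_div hd0).2 (by linarith))
  · gcongr
    rw [hp, div_div_eq_mul_div, div_mul_eq_mul_div, mul_comm]
    gcongr
    linarith

theorem tendsto_randomProb (hr : r ≠ 0)
    (hd : (fun n : ℕ => Real.log n) =o[atTop] (fun n : ℕ => (d n : ℝ)))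
    (hdn : ∀ᶠ n : ℕ in atTop, d n + r ≤ n) {ε : ℝ} (hε : 0 < ε) :
    Tendsto (fun n : ℕ => randomProb n (r + 1) (edgeProb n r (d n))
      (fun H =>
        (∀ R : Finset (Fin n), R.card = r → |(H.degree R : ℝ) - d n| ≤ ε * d n) ∧
        (H.indepNum : ℝ) ≤ (1 + ε) * ((r + 1).factorial : ℝ) ^ (1 / (r : ℝ)) *
          ((n : ℝ) / d n * Real.log n) ^ (1 / (r : ℝ)))) atTop (𝓝 1) := by
  have hdegree := tendsto_randomProb_degree_deviation r hd hdn hε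
  have hindep := tendsto_randomProb_lt_indepNum hr (eventually_one_le_of_log_isLittleO hd) hdn hε
  have hlim := (hdegree.add hindep).const_sub 1
  simp_rw [add_zero, sub_zero, ← not_le] at hlim
  exact tendsto_of_tendsto_of_tendsto_of_le_of_le hlim tendsto_const_nhds
    (fun n => one_sub_add_le_randomProb_and _ _) fun n => randomProb_le_one _

theorem tendsto_randomProb_of_log_isLittleO (hr : r ≠ 0)
    (hd : (fun n : ℕ => Real.log n) =o[atTop] (fun n : ℕ => (d n : ℝ)))
    (hdl : (fun n : ℕ => Real.log (d n)) =o[atTop] (fun n : ℕ => Real.log n))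
    {ε : ℝ} (hε : 0 < ε) :
    Tendsto (fun n : ℕ => randomProb n (r + 1) (edgeProb n r (d n))
      (fun H =>
        (∀ R : Finset (Fin n), R.card = r → |(H.degree R : ℝ) - d n| ≤ ε * d n) ∧
        (H.indepNum : ℝ) ≤ (1 + ε) * ((r + 1).factorial : ℝ) ^ (1 / (r : ℝ)) *
          ((n : ℝ) / d n * Real.log ((n : ℝ) / d n)) ^ (1 / (r : ℝ)))) atTop (𝓝 1) := by
  have hd1 := eventually_one_le_of_log_isLittleO hd
  set C := (1 + ε) / (1 + ε / 2) with hC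
  have hC1 : 1 < C := (one_lt_div (by linarith)).2 (by linarith)
  refine tendsto_of_tendsto_of_tendsto_of_le_of_le'
    (tendsto_randomProb hr hd (eventually_add_le r hd1 hdl) (half_pos hε)) tendsto_const_nhds ?_
    (.of_forall fun n => randomProb_le_one _)
  filter_upwards [eventually_log_le_mul_log_div hd1 hdl hC1] with n hn
  refine randomProb_mono fun H hH => ⟨fun R hR => (hH.1 R hR).trans ?_, hH.2.trans ?_⟩
  · gcongr
    linarith
  have hle : (n : ℝ) / d n * Real.log n ≤ C * ((n : ℝ) / d n * Real.log ((n : ℝ) / d n)) := by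
    rw [mul_left_comm]
    gcongr
  calc _ ≤ (1 + ε / 2) * ((r + 1).factorial : ℝ) ^ (1 / (r : ℝ)) *
          (C * ((n : ℝ) / d n * Real.log ((n : ℝ) / d n)) ^ (1 / (r : ℝ))) := by
        gcongr
        exact rpow_one_div_le_mul_rpow_of_le_mul hr hC1.le (by positivity) hle
    _ = _ := by
        rw [hC]
        field_simp

theorem le_sq_mul_floor_div {c x : ℝ} (hc : 1 < c) (hx : c ^ 2 ≤ (c - 1) * x) :
    x ≤ c ^ 2 * ⌊x / c⌋₊ := by
  have hfloor := (Nat.lt_floor_add_one (x / c)).le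
  rw [div_le_iff₀ (by linarith)] at hfloor
  nlinarith [mul_le_mul_of_nonneg_right hfloor (by linarith : 0 ≤ c)]

theorem eventually_le_sq_mul_floor_div
    (hd : (fun n : ℕ => Real.log n) =o[atTop] (fun n : ℕ => (d n : ℝ))) {c : ℝ} (hc : 1 < c) :
    ∀ᶠ n in atTop, (d n : ℝ) ≤ c ^ 2 * ⌊(d n : ℝ) / c⌋₊ := by
  filter_upwards [eventually_mul_log_le_of_log_isLittleO hd (sub_pos.2 hc)
    (show 0 < c ^ 2 by positivity), tendsto_log_natCast_atTop.eventually_ge_atTop 1] with n hn hlog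
  exact le_sq_mul_floor_div hc (hn.trans' (le_mul_of_one_le_right (sq_nonneg c) hlog))

theorem div_mul_le_pow_three_mul {c x y z ℓ L : ℝ} (hc : 0 < c) (hx : 0 ≤ x) (hy : 0 < y)
    (hz : y ≤ c ^ 2 * z) (hℓ : 0 ≤ ℓ) (hL : ℓ ≤ c * L) :
    x / z * ℓ ≤ c ^ 3 * (x / y * L) := by
  have hz0 : 0 < z := pos_of_mul_pos_right (hy.trans_le hz) (by positivity)
  have hdiv : x / z ≤ c ^ 2 * (x / y) := by
    rw [mul_div_assoc', div_le_div_iff₀ hz0 hy, mul_comm (c ^ 2), mul_assoc]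
    gcongr
  calc x / z * ℓ ≤ c ^ 2 * (x / y) * (c * L) := by gcongr
    _ = c ^ 3 * (x / y * L) := by ring

theorem eventually_exists_maxDegree_eq_indepNum_le_floor_div (hr : r ≠ 0)
    (hd : (fun n : ℕ => Real.log n) =o[atTop] (fun n : ℕ => (d n : ℝ)))
    (hdn : ∀ᶠ n : ℕ in atTop, d n + r ≤ n) {c : ℝ} (hc : 1 < c) :
    ∀ᶠ n : ℕ in atTop, ∃ H : KGraph (r + 1) (Fin n), H.maxDegree = d n ∧
      (H.indepNum : ℝ) ≤ c * ((r + 1).factorial : ℝ) ^ (1 / (r : ℝ)) *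
        ((n : ℝ) / ⌊(d n : ℝ) / c⌋₊ * Real.log n) ^ (1 / (r : ℝ)) := by
  -- Random graphs of the smaller expected degree `d'` have maximum degree at most `c * d' ≤ d`.
  set d' : ℕ → ℕ := fun n => ⌊(d n : ℝ) / c⌋₊
  have hd'_le (n) : c * (d' n : ℝ) ≤ d n := by
    rw [mul_comm, ← le_div_iff₀ (by linarith)]
    exact Nat.floor_le (by positivity)
  have hd' : (fun n : ℕ => Real.log n) =o[atTop] (fun n : ℕ => (d' n : ℝ)) :=
    hd.trans_isBigO <| .of_bound (c ^ 2) <|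
      (eventually_le_sq_mul_floor_div hd hc).mono fun n hn => by simpa using hn
  have hd'n : ∀ᶠ n in atTop, d' n + r ≤ n := hdn.mono fun n hn => by
    have : d' n ≤ d n := Nat.floor_le_of_le (div_le_self (d n).cast_nonneg hc.le)
    omega
  have hprob := (tendsto_randomProb hr hd' hd'n (sub_pos.2 hc)).eventually
    (lt_mem_nhds zero_lt_one)
  filter_upwards [hprob, hdn] with n hn hnd
  obtain ⟨H, hdegree, hα⟩ := exists_of_randomProb_pos hn
  have hmax : H.maxDegree ≤ d n := maxDegree_le_iff.2 fun R hR => by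
    have := (le_abs_self _).trans (hdegree R hR)
    exact_mod_cast (by linarith [hd'_le n] : (H.degree R : ℝ) ≤ d n)
  obtain ⟨H', hsub, hH'⟩ := exists_edges_subset_maxDegree_eq H hmax (by rwa [Fintype.card_fin])
  rw [add_sub_cancel] at hα
  exact ⟨H', hH', (Nat.cast_le.2 (indepNum_le_of_edges_subset hsub)).trans hα⟩

theorem eventually_exists_maxDegree_eq_indepNum_le (hr : r ≠ 0)
    (hd : (fun n : ℕ => Real.log n) =o[atTop] (fun n : ℕ => (d n : ℝ)))
    (hdl : (fun n : ℕ => Real.log (d n)) =o[atTop] (fun n : ℕ => Real.log n))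
    {ε : ℝ} (hε : 0 < ε) :
    ∀ᶠ n : ℕ in atTop, ∃ H : KGraph (r + 1) (Fin n), H.maxDegree = d n ∧
      (H.indepNum : ℝ) ≤ (1 + ε) * ((r + 1).factorial : ℝ) ^ (1 / (r : ℝ)) *
        ((n : ℝ) / d n * Real.log ((n : ℝ) / d n)) ^ (1 / (r : ℝ)) := by
  set c := (1 + ε) ^ (1 / 4 : ℝ)
  have hc : 1 < c := Real.one_lt_rpow (by linarith) (by norm_num)
  have hc4 : c ^ 4 = 1 + ε := by
    rw [← Real.rpow_mul_natCast (by linarith)]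
    norm_num
  have hd1 := eventually_one_le_of_log_isLittleO hd
  filter_upwards [eventually_exists_maxDegree_eq_indepNum_le_floor_div hr hd
      (eventually_add_le r hd1 hdl) hc, eventually_le_sq_mul_floor_div hd hc,
    eventually_log_le_mul_log_div hd1 hdl hc, hd1] with n ⟨H, hH, hα⟩ hfloor hlog hdn
  refine ⟨H, hH, hα.trans ?_⟩
  have hle := div_mul_le_pow_three_mul (by linarith) n.cast_nonneg (by exact_mod_cast hdn) hfloor
    (Real.log_natCast_nonneg n) hlog
  calc _ ≤ c * ((r + 1).factorial : ℝ) ^ (1 / (r : ℝ)) * (c ^ 3 *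
          ((n : ℝ) / d n * Real.log ((n : ℝ) / d n)) ^ (1 / (r : ℝ))) := by
        gcongr
        exact rpow_one_div_le_mul_rpow_of_le_mul hr (one_le_pow₀ hc.le) (by positivity) hle
    _ = _ := by
        rw [← hc4]
        ring

theorem log_isLittleO_ceil_log_sq :
    (fun n : ℕ => Real.log n) =o[atTop] (fun n : ℕ => (⌈Real.log n ^ 2⌉₊ : ℝ)) := by
  have hsq : (fun x : ℝ => x) =o[atTop] (fun x : ℝ => x ^ 2) := by
    simpa using isLittleO_pow_pow_atTop_of_lt (𝕜 := ℝ) one_lt_two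
  refine (hsq.comp_tendsto tendsto_log_natCast_atTop).trans_le fun n => ?_
  rw [Function.comp_apply, Real.norm_of_nonneg (sq_nonneg _), Real.norm_natCast]
  exact Nat.le_ceil _

theorem eventually_ceil_log_sq_le :
    ∀ᶠ n : ℕ in atTop, (⌈Real.log n ^ 2⌉₊ : ℝ) ≤ Real.log n ^ 3 := by
  filter_upwards [tendsto_log_natCast_atTop.eventually_ge_atTop 2] with n hn
  refine (Nat.ceil_lt_add_one (sq_nonneg (Real.log n))).le.trans ?_
  nlinarith [sq_nonneg (Real.log n)]

theorem log_ceil_log_sq_isLittleO :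
    (fun n : ℕ => Real.log (⌈Real.log n ^ 2⌉₊ : ℝ)) =o[atTop] (fun n : ℕ => Real.log n) := by
  have hloglog : (fun n : ℕ => Real.log (Real.log n)) =o[atTop] (fun n : ℕ => Real.log n) :=
    Real.isLittleO_log_id_atTop.comp_tendsto tendsto_log_natCast_atTop
  refine IsBigO.trans_isLittleO (.of_bound 3 ?_) hloglog
  filter_upwards [eventually_ceil_log_sq_le, tendsto_log_natCast_atTop.eventually_ge_atTop 1]
    with n hle hlog
  have hceil : (0 : ℝ) < ⌈Real.log n ^ 2⌉₊ := by
    exact_mod_cast Nat.ceil_pos.2 (by positivity)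
  rw [Real.norm_of_nonneg (Real.log_natCast_nonneg _), Real.norm_of_nonneg (Real.log_nonneg hlog)]
  simpa using Real.log_le_log hceil hle

theorem eventually_ceil_log_sq_lt_div_log_pow (s : ℕ) :
    ∀ᶠ n : ℕ in atTop, (⌈Real.log n ^ 2⌉₊ : ℝ) < (n : ℝ) / Real.log n ^ s := by
  have hpow := ((Real.isLittleO_pow_log_id_atTop (n := 3 + s)).comp_tendsto
    (tendsto_natCast_atTop_atTop (R := ℝ))).bound one_half_pos
  filter_upwards [hpow, eventually_ceil_log_sq_le,
    tendsto_log_natCast_atTop.eventually_ge_atTop 1, eventually_gt_atTop 0] with n hn hle hlog hn0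
  have hn0 : (0 : ℝ) < n := by exact_mod_cast hn0
  have hlogs : 0 < Real.log n ^ s := by positivity
  simp only [Function.comp_apply, id, Real.norm_natCast] at hn
  rw [Real.norm_of_nonneg (by positivity), pow_add] at hn
  rw [lt_div_iff₀ hlogs]
  linarith [mul_le_mul_of_nonneg_right hle hlogs.le]

theorem IsLowerBoundConstant.le_factorial_rpow (hr : r ≠ 0) {c : ℝ}
    (hc : IsLowerBoundConstant r c) : c ≤ ((r + 1).factorial : ℝ) ^ (1 / (r : ℝ)) := by
  set F := ((r + 1).factorial : ℝ) ^ (1 / (r : ℝ))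
  have hF0 : 0 < F := by positivity
  have hd := log_isLittleO_ceil_log_sq
  have hd1 := eventually_one_le_of_log_isLittleO hd
  have hdl := log_ceil_log_sq_isLittleO
  refine le_of_forall_pos_le_add fun η hη => ?_
  obtain ⟨n, hn, ⟨H, hH, hα⟩, hlt, hlog, hd1, hlog1⟩ := (hc.and <|
    (eventually_exists_maxDegree_eq_indepNum_le hr hd hdl (div_pos hη hF0)).and <|
    (eventually_ceil_log_sq_lt_div_log_pow (3 * r ^ 2)).and <|
    (eventually_log_le_mul_log_div hd1 hdl one_lt_two).and <|
    hd1.and (tendsto_log_natCast_atTop.eventually_ge_atTop 1)).exists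
  have hlower := hn H (by rwa [hH])
  rw [hH] at hlower
  have hn0 : (0 : ℝ) < n := by
    rcases n.eq_zero_or_pos with rfl | hn0
    · norm_num at hlog1
    · exact_mod_cast hn0
  have hscale : 0 < ((n : ℝ) / ⌈Real.log n ^ 2⌉₊ *
      Real.log ((n : ℝ) / ⌈Real.log n ^ 2⌉₊)) ^ (1 / (r : ℝ)) := by
    have hlogdiv : 0 < Real.log ((n : ℝ) / ⌈Real.log n ^ 2⌉₊) := by linarith
    positivity
  calc c ≤ (1 + η / F) * F := le_of_mul_le_mul_right (hlower.trans hα) hscale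
    _ = F + η := by rw [one_add_mul, div_mul_cancel₀ _ hF0.ne']

end Asymptotics

end KGraph

section Stirling

theorem div_exp_one_pow_le_factorial (r : ℕ) : ((r : ℝ) / Real.exp 1) ^ r ≤ r.factorial := by
  have h := Real.pow_div_factorial_le_exp (r : ℝ) r.cast_nonneg r
  rw [div_le_iff₀ (by positivity)] at h
  rwa [div_pow, Real.exp_one_pow, div_le_iff₀' (by positivity)]

theorem factorial_le_two_mul_mul_div_exp_one_pow {r : ℕ} (hr : 2 ≤ r) :
    (r.factorial : ℝ) ≤ 2 * r * ((r : ℝ) / Real.exp 1) ^ r := by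
  have hseq : Stirling.stirlingSeq r ≤ 2 := by
    have hle := Stirling.stirlingSeq'_antitone (Nat.zero_le (r - 1))
    simp only [Function.comp_apply, Nat.succ_eq_add_one, Nat.sub_add_cancel (by omega : 1 ≤ r),
      zero_add, Stirling.stirlingSeq_one] at hle
    have hsqrt : (1.4 : ℝ) ≤ √2 := Real.le_sqrt_of_sq_le (by norm_num)
    refine hle.trans ((div_le_iff₀ (by positivity)).2 ?_)
    linarith [Real.exp_one_lt_d9]
  have hsqrt : √(2 * r) ≤ (r : ℝ) := by
    have hr' : (2 : ℝ) ≤ r := by exact_mod_cast hr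
    rw [Real.sqrt_le_left (by positivity)]
    nlinarith
  calc (r.factorial : ℝ)
      = Stirling.stirlingSeq r * (√(2 * r) * ((r : ℝ) / Real.exp 1) ^ r) := by
        rw [Stirling.stirlingSeq, div_mul_cancel₀]
        positivity
    _ ≤ 2 * (r * ((r : ℝ) / Real.exp 1) ^ r) := by gcongr
    _ = 2 * r * ((r : ℝ) / Real.exp 1) ^ r := by ring

theorem factorial_succ_rpow_isEquivalent :
    (fun r : ℕ => ((r + 1).factorial : ℝ) ^ (1 / (r : ℝ)))
      ~[atTop] (fun r : ℕ => (r : ℝ) / Real.exp 1) := by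
  have hne : ∀ᶠ r : ℕ in atTop, (r : ℝ) / Real.exp 1 ≠ 0 := by
    filter_upwards [eventually_ne_atTop 0] with r hr
    positivity
  have hlim : Tendsto (fun r : ℕ => (r : ℝ) ^ (3 / (r : ℝ))) atTop (𝓝 1) :=
    ((tendsto_rpow_div_mul_add 3 1 0 zero_ne_one).comp
      (tendsto_natCast_atTop_atTop (R := ℝ))).congr fun r => by simp
  rw [isEquivalent_iff_tendsto_one hne]
  refine tendsto_of_tendsto_of_tendsto_of_le_of_le' tendsto_const_nhds hlim ?_ ?_
  all_goals
    filter_upwards [eventually_ge_atTop 4] with r hr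
    have hr4 : (4 : ℝ) ≤ r := by exact_mod_cast hr
    have hroot : (r : ℝ) / Real.exp 1 = (((r : ℝ) / Real.exp 1) ^ r) ^ (1 / (r : ℝ)) := by
      rw [one_div, Real.pow_rpow_inv_natCast (by positivity) (by omega)]
    rw [Pi.div_apply]
  · rw [one_le_div (by positivity), hroot]
    gcongr
    exact (div_exp_one_pow_le_factorial r).trans (by exact_mod_cast Nat.factorial_le r.le_succ)
  · have hcube : (r : ℝ) ^ (3 / (r : ℝ)) = ((r : ℝ) ^ 3) ^ (1 / (r : ℝ)) := by
      rw [← Real.rpow_natCast, ← Real.rpow_mul r.cast_nonneg, mul_one_div, Nat.cast_ofNat]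
    rw [div_le_iff₀ (by positivity), hcube, hroot, ← Real.mul_rpow (by positivity) (by positivity)]
    gcongr
    calc ((r + 1).factorial : ℝ) = (r + 1) * r.factorial := by
          rw [Nat.factorial_succ, Nat.cast_mul, Nat.cast_succ]
      _ ≤ (r + 1) * (2 * r * ((r : ℝ) / Real.exp 1) ^ r) := by
          gcongr
          exact factorial_le_two_mul_mul_div_exp_one_pow (by omega)
      _ = (2 * (r + 1)) * r * ((r : ℝ) / Real.exp 1) ^ r := by ring
      _ ≤ r ^ 2 * r * ((r : ℝ) / Real.exp 1) ^ r := by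
          gcongr
          nlinarith
      _ = r ^ 3 * ((r : ℝ) / Real.exp 1) ^ r := by ring

theorem eventually_factorial_succ_rpow_le {ε : ℝ} (hε : 0 < ε) :
    ∀ᶠ r : ℕ in atTop,
      ((r + 1).factorial : ℝ) ^ (1 / (r : ℝ)) ≤ (1 + ε) * ((r : ℝ) / Real.exp 1) := by
  obtain ⟨φ, hφ, heq⟩ := factorial_succ_rpow_isEquivalent.exists_eq_mul
  filter_upwards [heq, hφ.eventually (ge_mem_nhds (by linarith : 1 < 1 + ε))] with r hr hφr
  rw [hr, Pi.mul_apply]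
  gcongr

end Stirling

theorem mainTheorem3 :
    (∀ r : ℕ, 2 ≤ r →
      -- blowups of partial Steiner systems: maximum degree and independence number
      (∀ (m : ℕ) (S : KGraph (r + 1) (Fin m)), S.IsPartialSteiner → S.edges.Nonempty →
        ∀ d : ℕ, 1 ≤ d →
          (S.blowup d).maxDegree = d ∧ (S.blowup d).indepNum = min r d * S.indepNum) ∧
      -- Steiner systems with small independence number, and their blowups (on `N = m d` vertices)
      (∃ a b : ℝ, 0 < a ∧ 0 < b ∧ ∀ m : ℕ, r + 1 ≤ m →
        ∃ S : KGraph (r + 1) (Fin m), S.IsPartialSteiner ∧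
          (S.indepNum : ℝ) ≤ a * ((m : ℝ) * Real.log m) ^ (1 / (r : ℝ)) ∧
          ∀ d N : ℕ, 1 ≤ d → N = m * d →
            (S.blowup d).maxDegree = d ∧
            ((S.blowup d).indepNum : ℝ)
              ≤ b * ((N : ℝ) / d * Real.log ((N : ℝ) / d)) ^ (1 / (r : ℝ))) ∧
      -- examples for every `d` and every number `n > r d` of vertices
      (∃ b : ℝ, 0 < b ∧ ∀ d n : ℕ, 1 ≤ d → r * d < n →
        ∃ H : KGraph (r + 1) (Fin n), H.maxDegree = d ∧
          (H.indepNum : ℝ)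
            ≤ b * ((n : ℝ) / d * Real.log ((n : ℝ) / d)) ^ (1 / (r : ℝ))) ∧
      -- the random hypergraph when `log n ≪ d`
      (∀ d : ℕ → ℕ, (fun n : ℕ => Real.log n) =o[atTop] (fun n : ℕ => (d n : ℝ)) →
        (∀ᶠ n : ℕ in atTop, d n + r ≤ n) →
        ∀ ε : ℝ, 0 < ε →
          Tendsto (fun n : ℕ => KGraph.randomProb n (r + 1) (KGraph.edgeProb n r (d n))
            (fun H =>
              (∀ R : Finset (Fin n), R.card = r → |(H.degree R : ℝ) - d n| ≤ ε * d n) ∧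
              (H.indepNum : ℝ) ≤ (1 + ε) * ((r + 1).factorial : ℝ) ^ (1 / (r : ℝ)) *
                ((n : ℝ) / d n * Real.log n) ^ (1 / (r : ℝ)))) atTop (𝓝 1)) ∧
      -- the random hypergraph when `log n ≪ d` and `log d ≪ log n`, and the resulting examples
      -- with maximum `r`-degree exactly `d`
      (∀ d : ℕ → ℕ, (fun n : ℕ => Real.log n) =o[atTop] (fun n : ℕ => (d n : ℝ)) →
        (fun n : ℕ => Real.log (d n)) =o[atTop] (fun n : ℕ => Real.log n) →
        ∀ ε : ℝ, 0 < ε →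
          Tendsto (fun n : ℕ => KGraph.randomProb n (r + 1) (KGraph.edgeProb n r (d n))
            (fun H =>
              (∀ R : Finset (Fin n), R.card = r → |(H.degree R : ℝ) - d n| ≤ ε * d n) ∧
              (H.indepNum : ℝ) ≤ (1 + ε) * ((r + 1).factorial : ℝ) ^ (1 / (r : ℝ)) *
                ((n : ℝ) / d n * Real.log ((n : ℝ) / d n)) ^ (1 / (r : ℝ)))) atTop (𝓝 1) ∧
          ∀ᶠ n : ℕ in atTop, ∃ H : KGraph (r + 1) (Fin n), H.maxDegree = d n ∧
            (H.indepNum : ℝ) ≤ (1 + ε) * ((r + 1).factorial : ℝ) ^ (1 / (r : ℝ)) *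
              ((n : ℝ) / d n * Real.log ((n : ℝ) / d n)) ^ (1 / (r : ℝ))) ∧
      -- no constant in the lower bound exceeds `(r+1)!^{1/r}`
      (∀ c : ℝ, KGraph.IsLowerBoundConstant r c →
        c ≤ ((r + 1).factorial : ℝ) ^ (1 / (r : ℝ)))) ∧
    -- `(r+1)!^{1/r} ∼ r/e`, so the constants in the lower bound are at most `(1 + o(1)) r/e`
    (fun r : ℕ => ((r + 1).factorial : ℝ) ^ (1 / (r : ℝ)))
      ~[atTop] (fun r : ℕ => (r : ℝ) / Real.exp 1) ∧
    (∀ c : ℕ → ℝ, (∀ r : ℕ, 2 ≤ r → KGraph.IsLowerBoundConstant r (c r)) →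
      ∀ ε : ℝ, 0 < ε → ∀ᶠ r : ℕ in atTop, c r ≤ (1 + ε) * ((r : ℝ) / Real.exp 1)) := by
  refine ⟨fun r hr => ⟨?_, ?_, ?_, ?_, ?_, ?_⟩, factorial_succ_rpow_isEquivalent, ?_⟩
  · exact fun m S hS hne d _ => ⟨KGraph.maxDegree_blowup hr hS hne, KGraph.indepNum_blowup S⟩
  · exact KGraph.exists_isPartialSteiner_indepNum_blowup_le hr
  · exact KGraph.exists_maxDegree_eq_indepNum_le hr
  · exact fun d hd hdn ε hε => KGraph.tendsto_randomProb (by omega) hd hdn hε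
  · exact fun d hd hdl ε hε =>
      ⟨KGraph.tendsto_randomProb_of_log_isLittleO (by omega) hd hdl hε,
        KGraph.eventually_exists_maxDegree_eq_indepNum_le (by omega) hd hdl hε⟩
  · exact fun c hc => hc.le_factorial_rpow (by omega)
  · intro c hc ε hε
    filter_upwards [eventually_factorial_succ_rpow_le hε, eventually_ge_atTop 2] with r hstirling hr
    exact ((hc r hr).le_factorial_rpow (by omega)).trans hstirling
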